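/- **Theorem (Schauder–Hölder–Zygmund estimates).** Let $n\ge1$ and $0<s<\min\{1,n/2\}$. There is a constant $C>0$, depending only on $n$ and $s$, such that the following holds for every (complex-valued) $f\in L^\infty(\mathbb{R}^n)$ with compact support. Put $$u(x)=(-\Delta)^{-s}f(x)=\frac1{\Gamma(s)}\int_0^\infty e^{t\Delta}f(x)\,\frac{dt}{t^{1-s}},\qquad e^{t\Delta}f(x)=\int_{\mathbb{R}^n}\frac{e^{-|x-z|^2/(4t)}}{(4\pi t)^{n/2}}f(z)\,dz .$$ The integral over $t$ converges absolutely for every $x\in\mathbb{R}^n$, and: (i) if $2s<1$, then $u\in C^{0,2s}(\mathbb{R}^n)$ and $\|u\|_{C^{0,2s}}\le C(\|u\|_{L^\infty}+\|f\|_{L^\infty})$; (ii) if $2s=1$, then $u\in\Lambda_*$ and $\|u\|_{\Lambda_*}\le C(\|u\|_{L^\infty}+\|f\|_{L^\infty})$; (iii) if $2s>1$, then $u\in C^{1,2s-1}(\mathbb{R}^n)$ and $\|u\|_{C^{1,2s-1}}\le C(\|u\|_{L^\infty}+\|f\|_{L^\infty})$. Moreover, $u$ is the unique bounded solution of $(-\Delta)^su=f$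 a.e. in $\mathbb{R}^n$ that vanishes at infinity: $u$ is bounded, $u(x)\to0$ as $|x|\to\infty$, $(-\Delta)^su(x)=f(x)$ for a.e. $x$; and every $w\in L^\infty(\mathbb{R}^n)$ that vanishes at infinity (for each $\varepsilon>0$ there is $R$ with $|w(x)|<\varepsilon$ for a.e. $|x|\ge R$) and satisfies $(-\Delta)^sw(x)=f(x)$ for a.e. $x$ is equal to $u$ almost everywhere. Here $\|u\|_{C^{0,\alpha}}=\sup|u|+[u]_\alpha$ and $\|u\|_{C^{1,\alpha}}=\sup|u|+\sup|Du|+[Du]_\alpha$, where $[v]_\alpha=\sup_{x\ne y}|v(x)-v(y)|/|x-y|^\alpha$; $\Lambda_*$ is the Zygmund space of all $u\in L^\infty(\mathbb{R}^n)$ for which $\|u\|_{\Lambda_*}=\|u\|_{L^\infty}+\sup_{x,\,h\ne0}|u(x+h)+u(x-h)-2u(x)|/|h|$ is finite. For a Schwartz function $\varphi$, $\widehat{(-\Delta)^s\varphi}(\xi)=|\xi|^{2s}\widehat\varphi(\xi)$, where $\widehat\varphi(\xi)=\int e^{-ix\cdot\xi}\varphi(x)\,dx$. For $w$ with $\int|w(x)|(1+|x|^{n+2s})^{-1}dx<\infty$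 (in particular for $w\in L^\infty$), $(-\Delta)^sw$ is the distribution $\langle(-\Delta)^sw,\varphi\rangle=\int w\,(-\Delta)^s\varphi\,dx$, $\varphi$ a Schwartz function; and $(-\Delta)^sw=f$ a.e. means that this distribution is a function that equals $f$ almost everywhere. -/

import Mathlib

open MeasureTheory Filter Topology Set
open scoped NNReal ENNReal FourierTransform SchwartzMap

noncomputable section

/-- The Gauss--Weierstrass heat kernel `G_t(x) = (4πt)^{-n/2} exp(-|x|²/(4t))` on `ℝⁿ`. -/
def heatKernel {n : ℕ} (t : ℝ) (x : EuclideanSpace ℝ (Fin n)) : ℝ :=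
  (4 * Real.pi * t) ^ (-((n : ℝ) / 2)) * Real.exp (-‖x‖ ^ 2 / (4 * t))

/-- The heat semigroup `e^{tΔ} f(x) = ∫ G_t(x - z) f(z) dz`. -/
def heatSemigroup {n : ℕ} (t : ℝ) (f : EuclideanSpace ℝ (Fin n) → ℂ)
    (x : EuclideanSpace ℝ (Fin n)) : ℂ :=
  ∫ z, heatKernel t (x - z) • f z

/-- The negative power of the Laplacian, by the semigroup formula
`(-Δ)^{-s} f(x) = (1 / Γ(s)) ∫₀^∞ e^{tΔ} f(x) t^{s-1} dt`. -/
def invFracLaplacian {n : ℕ} (s : ℝ) (f : EuclideanSpace ℝ (Fin n) → ℂ)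
    (x : EuclideanSpace ℝ (Fin n)) : ℂ :=
  (1 / Real.Gamma s) • ∫ t in Ioi (0 : ℝ), t ^ (s - 1) • heatSemigroup t f x

/-- The fractional Laplacian of a Schwartz function: the inverse Fourier transform of
`|ξ|^{2s} φ̂(ξ)`. With Mathlib's normalisation `φ̂(ξ) = ∫ e^{-2πi x·ξ} φ(x) dx` the frequency
`|ξ|` of the Laplacian reads `2π‖ξ‖`. -/
def fracLaplacianSchwartz {n : ℕ} (s : ℝ) (φ : 𝓢(EuclideanSpace ℝ (Fin n), ℂ)) :
    EuclideanSpace ℝ (Fin n) → ℂ :=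
  𝓕⁻ (fun ξ : EuclideanSpace ℝ (Fin n) =>
    ((2 * Real.pi * ‖ξ‖) ^ (2 * s) : ℝ) • 𝓕 (φ : EuclideanSpace ℝ (Fin n) → ℂ) ξ)

/-- The weighted space `L_s` of functions with `∫ |w(x)| / (1 + |x|^{n+2s}) dx < ∞`. -/
def MemLs {n : ℕ} (s : ℝ) (w : EuclideanSpace ℝ (Fin n) → ℂ) : Prop :=
  Integrable (fun x => (1 + ‖x‖ ^ ((n : ℝ) + 2 * s))⁻¹ • w x) volume

/-- The distribution `(-Δ)^s w`, defined for `w ∈ L_s` by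
`⟨(-Δ)^s w, φ⟩ = ⟨w, (-Δ)^s φ⟩ = ∫ w (-Δ)^s φ` for all Schwartz functions `φ`,
is the function `g`. -/
def HasFracLaplacian {n : ℕ} (s : ℝ) (w g : EuclideanSpace ℝ (Fin n) → ℂ) : Prop :=
  MemLs s w ∧
    ∀ φ : 𝓢(EuclideanSpace ℝ (Fin n), ℂ),
      Integrable (fun x => g x * φ x) volume ∧
        ∫ x, w x * fracLaplacianSchwartz s φ x = ∫ x, g x * φ x

/-- `(-Δ)^s w(x) = f(x)` for almost every `x`: the distribution `(-Δ)^s w` is a function, and this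
function is equal to `f` almost everywhere. -/
def FracLaplacianEqAE {n : ℕ} (s : ℝ) (w f : EuclideanSpace ℝ (Fin n) → ℂ) : Prop :=
  ∃ g : EuclideanSpace ℝ (Fin n) → ℂ, HasFracLaplacian s w g ∧ g =ᵐ[volume] f

/-- The norm of `C^{0,α}(ℝⁿ)`: the sup norm plus the Hölder seminorm. -/
def holderNormZero {n : ℕ} (α : ℝ≥0) (u : EuclideanSpace ℝ (Fin n) → ℂ) : ℝ≥0∞ :=
  (⨆ x, ‖u x‖ₑ) + eHolderNorm α u

/-- `u ∈ C^{0,α}(ℝⁿ)`. -/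
def MemHolderZero {n : ℕ} (α : ℝ≥0) (u : EuclideanSpace ℝ (Fin n) → ℂ) : Prop :=
  Continuous u ∧ holderNormZero α u < ∞

/-- The norm of `C^{1,α}(ℝⁿ)`: the sup norms of `u` and of `Du` plus the Hölder seminorm of
`Du`. -/
def holderNormOne {n : ℕ} (α : ℝ≥0) (u : EuclideanSpace ℝ (Fin n) → ℂ) : ℝ≥0∞ :=
  (⨆ x, ‖u x‖ₑ) + (⨆ x, ‖fderiv ℝ u x‖ₑ) + eHolderNorm α (fderiv ℝ u)

/-- `u ∈ C^{1,α}(ℝⁿ)`. -/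
def MemHolderOne {n : ℕ} (α : ℝ≥0) (u : EuclideanSpace ℝ (Fin n) → ℂ) : Prop :=
  ContDiff ℝ 1 u ∧ holderNormOne α u < ∞

/-- The Zygmund seminorm `sup_{x, h ≠ 0} |u(x+h) + u(x-h) - 2u(x)| / |h|`. -/
def zygmundSeminorm {n : ℕ} (u : EuclideanSpace ℝ (Fin n) → ℂ) : ℝ≥0∞ :=
  ⨆ (x : EuclideanSpace ℝ (Fin n)) (h : EuclideanSpace ℝ (Fin n)) (_ : h ≠ 0),
    ‖u (x + h) + u (x - h) - 2 * u x‖ₑ / ‖h‖ₑ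

/-- The norm of the Zygmund space `Λ_*`. -/
def zygmundNorm {n : ℕ} (u : EuclideanSpace ℝ (Fin n) → ℂ) : ℝ≥0∞ :=
  eLpNorm u ∞ volume + zygmundSeminorm u

/-- `u ∈ Λ_*`. -/
def MemZygmund {n : ℕ} (u : EuclideanSpace ℝ (Fin n) → ℂ) : Prop :=
  MemLp u ∞ volume ∧ zygmundSeminorm u < ∞

/-- `w` vanishes at infinity up to a null set: for every `ε > 0` there is a ball outside of
which `|w| < ε` almost everywhere. -/
def VanishesAtInfinityAE {n : ℕ} (w : EuclideanSpace ℝ (Fin n) → ℂ) : Prop :=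
  ∀ ε : ℝ, 0 < ε → ∃ R : ℝ, ∀ᵐ x ∂volume, R ≤ ‖x‖ → ‖w x‖ < ε

end

/-! ### The Gauss–Weierstrass kernel: mass, Fourier transform, Gaussian bounds. -/

section HeatKernel

variable {n : ℕ}

/-! Regularity comes from the smoothing of the heat semigroup. If `|f| ≤ M` a.e., then `|e^{tΔ}f| ≤
M`, the gradient of `e^{tΔ}f` is at most `c M t^{-1/2}`, and this gradient is Lipschitz with
constant `c M t^{-1}`. A first or second difference of `u` with step `h` is the integral over `t`,
with weight `t^{s-1}`, of the same difference of `e^{tΔ}f`. Cut this integral at `t = |h|²`, the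
time in which heat spreads over the distance `|h|`. Before the cut the trivial bound is used, after
it the smoothing bound, and both pieces scale like `|h|^{2s}`. For `2s > 1` the same cut is applied
to the gradient, with exponent `2s - 1`; `sup |Du|` then follows from `sup |u|` and the Hölder
seminorm of `Du` by interpolation. None of these constants sees the support of `f`. Integrability of
`f` serves for differentiation under the integral and gives the decay `t^{-n/2}` for large `t`; with
`s < n/2` this decay makes the integral converge, with a majorant independent of `x`, and hence `u`
is bounded, continuous and vanishing at infinity.

That `u` solves the equation is a Fourier computation: `∫ t^{s-1} e^{-t|ξ|²} dt = Γ(s)|ξ|^{-2s}`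
cancels the symbol `|ξ|^{2s}`. As `u` is merely bounded, the pairing with `(-Δ)^s φ` needs `(-Δ)^s φ
∈ L¹`, although the symbol is not smooth at the origin. This is `integrable_symbol_mul_fourier`: the
symbol has the form `K̂₁|ξ|² + K̂₂` with integrable `K₁`, `K₂` built from heat kernels.

Uniqueness is the Liouville theorem `ae_eq_zero_of_fracLaplacian_eq_zero`. Let `v` be bounded,
vanishing at infinity and annihilated by `(-Δ)^s`. Then `v` is orthogonal to every function whose
Fourier transform is smooth, compactly supported and zero near the origin. Take `K` with `K̂` a bump
equal to 1 near 0. For a test function `θ`, the differences `(K̂(εξ) - K̂(Rξ)) θ̂(ξ)` are such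
transforms, so the average of the correlation of `v` with `θ` against the dilates of `K` does not
depend on the scale. At scale 0 it is `∫ vθ`, at scale infinity it is 0. -/

theorem heatKernel_nonneg {t : ℝ} (ht : 0 < t) (x : EuclideanSpace ℝ (Fin n)) :
    0 ≤ heatKernel t x := by
  unfold heatKernel; positivity

theorem heatKernel_neg (t : ℝ) (x : EuclideanSpace ℝ (Fin n)) :
    heatKernel t (-x) = heatKernel t x := by
  simp [heatKernel]

theorem continuous_heatKernel (t : ℝ) :
    Continuous (heatKernel t : EuclideanSpace ℝ (Fin n) → ℝ) := by
  unfold heatKernel; fun_prop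

theorem measurable_heatKernel_uncurry :
    Measurable (fun p : ℝ × EuclideanSpace ℝ (Fin n) => heatKernel p.1 p.2) := by
  unfold heatKernel; fun_prop

theorem heatKernel_le {t : ℝ} (ht : 0 < t) (x : EuclideanSpace ℝ (Fin n)) :
    heatKernel t x ≤ (4 * Real.pi * t) ^ (-((n : ℝ) / 2)) := by
  unfold heatKernel
  refine mul_le_of_le_one_right (by positivity) (Real.exp_le_one_iff.2 ?_)
  rw [neg_div]
  exact neg_nonpos.2 (by positivity)

theorem fourier_heatKernel {t : ℝ} (ht : 0 < t) (ξ : EuclideanSpace ℝ (Fin n)) :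
    𝓕 (fun x : EuclideanSpace ℝ (Fin n) => (heatKernel t x : ℂ)) ξ =
      (Real.exp (-(t * (2 * Real.pi * ‖ξ‖) ^ 2)) : ℝ) := by
  have hb : 0 < ((1 / (4 * t) : ℝ) : ℂ).re := by rw [Complex.ofReal_re]; positivity
  have h := fourier_gaussian_innerProductSpace (V := EuclideanSpace ℝ (Fin n)) hb ξ
  have hpos : 0 < 4 * Real.pi * t := by positivity
  have e1 : (fun x : EuclideanSpace ℝ (Fin n) => (heatKernel t x : ℂ)) =
      (((4 * Real.pi * t) ^ (-((n : ℝ) / 2)) : ℝ) : ℂ) •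
        fun v : EuclideanSpace ℝ (Fin n) =>
          Complex.exp (-((1 / (4 * t) : ℝ) : ℂ) * (‖v‖ : ℂ) ^ 2) := by
    funext x
    simp only [heatKernel, Pi.smul_apply, smul_eq_mul]
    push_cast
    congr 2
    have : (t : ℂ) ≠ 0 := by exact_mod_cast ht.ne'
    field_simp
  have e2 : (Real.pi : ℂ) / ((1 / (4 * t) : ℝ) : ℂ) = ((4 * Real.pi * t : ℝ) : ℂ) := by
    push_cast; field_simp
  rw [e1, Real.fourier_eq]
  simp only [Pi.smul_apply]
  simp_rw [smul_comm _ ((((4 * Real.pi * t) ^ (-((n : ℝ) / 2)) : ℝ) : ℂ))]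
  rw [integral_smul, ← Real.fourier_eq, h, e2]
  have e3 : ((4 * Real.pi * t : ℝ) : ℂ) ^ ((Module.finrank ℝ (EuclideanSpace ℝ (Fin n)) : ℂ) / 2) =
      (((4 * Real.pi * t) ^ ((n : ℝ) / 2) : ℝ) : ℂ) := by
    rw [finrank_euclideanSpace_fin, Complex.ofReal_cpow hpos.le]
    push_cast; rfl
  rw [e3, smul_eq_mul, ← mul_assoc, ← Complex.ofReal_mul, ← Real.rpow_add hpos]
  simp only [neg_add_cancel, Real.rpow_zero, Complex.ofReal_one, one_mul]
  push_cast
  congr 1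
  have : (t : ℂ) ≠ 0 := by exact_mod_cast ht.ne'
  field_simp
  ring

theorem integrable_heatKernel {t : ℝ} (ht : 0 < t) :
    Integrable (heatKernel t : EuclideanSpace ℝ (Fin n) → ℝ) := by
  have h := (GaussianFourier.integrable_cexp_neg_mul_sq_norm_add (V := EuclideanSpace ℝ (Fin n))
    (b := ((1 / (4 * t) : ℝ) : ℂ)) (by rw [Complex.ofReal_re]; positivity) 0 0).norm
  have h2 := h.const_mul ((4 * Real.pi * t) ^ (-((n : ℝ) / 2)))
  refine h2.congr (Eventually.of_forall fun x => ?_)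
  simp only [heatKernel]
  congr 1
  have : (-((1 / (4 * t) : ℝ) : ℂ) * (‖x‖ : ℂ) ^ 2 + 0 * (inner ℝ 0 x : ℝ)) =
      ((-‖x‖ ^ 2 / (4 * t) : ℝ) : ℂ) := by
    push_cast; ring
  rw [this, ← Complex.ofReal_exp, Complex.norm_real, Real.norm_of_nonneg (Real.exp_nonneg _)]

theorem integral_heatKernel {t : ℝ} (ht : 0 < t) :
    ∫ x : EuclideanSpace ℝ (Fin n), heatKernel t x = 1 := by
  have h := fourier_heatKernel ht (0 : EuclideanSpace ℝ (Fin n))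
  rw [Real.fourier_eq] at h
  simp only [inner_zero_right, neg_zero, AddChar.map_zero_eq_one, one_smul, norm_zero, mul_zero,
    ne_eq, OfNat.ofNat_ne_zero, not_false_eq_true, zero_pow, Real.exp_zero] at h
  rw [integral_complex_ofReal] at h
  exact_mod_cast h

/-- Half of the Gaussian exponent becomes the kernel at time `2t`; the other half is left to absorb
powers of `‖x‖`. -/
theorem heatKernel_eq_mul_exp {t : ℝ} (ht : 0 < t) (x : EuclideanSpace ℝ (Fin n)) :
    heatKernel t x = (2 : ℝ) ^ ((n : ℝ) / 2) * heatKernel (2 * t) x *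
      Real.exp (-(‖x‖ ^ 2 / (8 * t))) := by
  unfold heatKernel
  have h1 : (4 * Real.pi * (2 * t)) ^ (-((n : ℝ) / 2)) =
      (2 : ℝ) ^ (-((n : ℝ) / 2)) * (4 * Real.pi * t) ^ (-((n : ℝ) / 2)) := by
    rw [← Real.mul_rpow (by positivity) (by positivity)]; congr 1; ring
  have h2 : (2 : ℝ) ^ ((n : ℝ) / 2) * (2 : ℝ) ^ (-((n : ℝ) / 2)) = 1 := by
    rw [← Real.rpow_add two_pos]; simp
  have h3 : Real.exp (-‖x‖ ^ 2 / (4 * t)) =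
      Real.exp (-‖x‖ ^ 2 / (4 * (2 * t))) * Real.exp (-(‖x‖ ^ 2 / (8 * t))) := by
    rw [← Real.exp_add]; congr 1; field_simp; ring
  rw [h1, h3]
  linear_combination (-(4 * Real.pi * t) ^ (-((n : ℝ) / 2)) *
    Real.exp (-‖x‖ ^ 2 / (4 * (2 * t))) * Real.exp (-(‖x‖ ^ 2 / (8 * t)))) * h2

theorem norm_sq_mul_heatKernel_le {t : ℝ} (ht : 0 < t) (x : EuclideanSpace ℝ (Fin n)) :
    ‖x‖ ^ 2 * heatKernel t x ≤ 8 * t * (2 : ℝ) ^ ((n : ℝ) / 2) * heatKernel (2 * t) x := by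
  have hG := heatKernel_nonneg (show 0 < 2 * t by positivity) x
  have ha : ‖x‖ ^ 2 * Real.exp (-(‖x‖ ^ 2 / (8 * t))) ≤ 8 * t := by
    have h1 : ‖x‖ ^ 2 / (8 * t) ≤ Real.exp (‖x‖ ^ 2 / (8 * t)) := by
      linarith [Real.add_one_le_exp (‖x‖ ^ 2 / (8 * t))]
    rw [Real.exp_neg, ← div_eq_mul_inv, div_le_iff₀ (Real.exp_pos _)]
    rwa [div_le_iff₀ (by positivity), mul_comm] at h1
  rw [heatKernel_eq_mul_exp ht x]
  calc ‖x‖ ^ 2 * ((2 : ℝ) ^ ((n : ℝ) / 2) * heatKernel (2 * t) x *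
        Real.exp (-(‖x‖ ^ 2 / (8 * t))))
      = (‖x‖ ^ 2 * Real.exp (-(‖x‖ ^ 2 / (8 * t)))) *
        ((2 : ℝ) ^ ((n : ℝ) / 2) * heatKernel (2 * t) x) := by ring
    _ ≤ (8 * t) * ((2 : ℝ) ^ ((n : ℝ) / 2) * heatKernel (2 * t) x) := by gcongr
    _ = _ := by ring

theorem heatKernel_le_two_mul {t : ℝ} (ht : 0 < t) (x : EuclideanSpace ℝ (Fin n)) :
    heatKernel t x ≤ (2 : ℝ) ^ ((n : ℝ) / 2) * heatKernel (2 * t) x := by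
  have hG := heatKernel_nonneg (show 0 < 2 * t by positivity) x
  rw [heatKernel_eq_mul_exp ht x]
  exact mul_le_of_le_one_right (by positivity)
    (Real.exp_le_one_iff.2 (neg_nonpos.2 (by positivity)))

theorem norm_mul_heatKernel_le {t : ℝ} (ht : 0 < t) (x : EuclideanSpace ℝ (Fin n)) :
    ‖x‖ * heatKernel t x ≤ 9 * Real.sqrt t * (2 : ℝ) ^ ((n : ℝ) / 2) * heatKernel (2 * t) x := by
  have hs : 0 < Real.sqrt t := Real.sqrt_pos.2 ht
  have hst : Real.sqrt t * Real.sqrt t = t := Real.mul_self_sqrt ht.le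
  have hG := heatKernel_nonneg ht x
  -- The first moment is reduced to the zeroth and the second, which contribute 1 and 8 to the
  -- constant 9.
  have h1 : ‖x‖ ≤ Real.sqrt t + ‖x‖ ^ 2 / Real.sqrt t := by
    rw [← sub_nonneg]
    have : Real.sqrt t + ‖x‖ ^ 2 / Real.sqrt t - ‖x‖ =
        ((Real.sqrt t - ‖x‖ / 2) ^ 2 + 3 / 4 * ‖x‖ ^ 2) / Real.sqrt t := by
      field_simp; ring
    rw [this]; positivity
  calc ‖x‖ * heatKernel t x ≤ (Real.sqrt t + ‖x‖ ^ 2 / Real.sqrt t) * heatKernel t x := by gcongr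
    _ = Real.sqrt t * heatKernel t x + (‖x‖ ^ 2 * heatKernel t x) / Real.sqrt t := by ring
    _ ≤ Real.sqrt t * ((2 : ℝ) ^ ((n : ℝ) / 2) * heatKernel (2 * t) x) +
        (8 * t * (2 : ℝ) ^ ((n : ℝ) / 2) * heatKernel (2 * t) x) / Real.sqrt t := by
      refine add_le_add (mul_le_mul_of_nonneg_left (heatKernel_le_two_mul ht x) hs.le) ?_
      exact div_le_div_of_nonneg_right (norm_sq_mul_heatKernel_le ht x) hs.le
    _ = _ := by
      have h8 : 8 * t * (2 : ℝ) ^ ((n : ℝ) / 2) * heatKernel (2 * t) x / Real.sqrt t =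
          8 * Real.sqrt t * (2 : ℝ) ^ ((n : ℝ) / 2) * heatKernel (2 * t) x := by
        rw [div_eq_iff hs.ne']
        linear_combination (-8 * (2 : ℝ) ^ ((n : ℝ) / 2) * heatKernel (2 * t) x) * hst
      rw [h8]; ring

theorem hasFDerivAt_heatKernel (t : ℝ) (x : EuclideanSpace ℝ (Fin n)) :
    HasFDerivAt (heatKernel t) ((-(heatKernel t x / (2 * t))) • innerSL ℝ x) x := by
  have h1 : HasFDerivAt (fun y : EuclideanSpace ℝ (Fin n) => -‖y‖ ^ 2 / (4 * t))
      ((4 * t)⁻¹ • (-((2 : ℝ) • innerSL ℝ x))) x := by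
    have := ((hasStrictFDerivAt_norm_sq x).hasFDerivAt.neg).const_smul (4 * t)⁻¹
    refine (this.congr_of_eventuallyEq (Eventually.of_forall fun y => ?_)).congr_fderiv ?_
    · simp [div_eq_inv_mul]
    · ext y; simp
  have h2 := (h1.exp).const_smul ((4 * Real.pi * t) ^ (-((n : ℝ) / 2)))
  refine h2.congr_fderiv ?_
  ext y
  simp [heatKernel]
  field_simp
  ring

end HeatKernel

/-! ### Convolution with a kernel: differentiation and sup bounds. -/

section Convolution

variable {n : ℕ} {F : Type*} [NormedAddCommGroup F] [NormedSpace ℂ F]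

theorem integrable_smul_comp_sub {f : EuclideanSpace ℝ (Fin n) → ℂ}
    {K : EuclideanSpace ℝ (Fin n) → F} (hf : Integrable f) (hK : Continuous K) {B : ℝ}
    (hB : ∀ x, ‖K x‖ ≤ B) (x : EuclideanSpace ℝ (Fin n)) :
    Integrable (fun z => f z • K (x - z)) := by
  refine (hf.norm.mul_const B).mono
    (hf.1.smul (hK.comp (continuous_sub_left x)).aestronglyMeasurable)
    (Eventually.of_forall fun z => ?_)
  rw [norm_smul, Real.norm_of_nonneg
    (mul_nonneg (norm_nonneg _) ((norm_nonneg _).trans (hB 0)))]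
  exact mul_le_mul_of_nonneg_left (hB _) (norm_nonneg _)

theorem hasFDerivAt_integral_smul_comp_sub [NormedSpace ℝ F] [SMulCommClass ℝ ℂ F]
    {f : EuclideanSpace ℝ (Fin n) → ℂ}
    {K : EuclideanSpace ℝ (Fin n) → F}
    {K' : EuclideanSpace ℝ (Fin n) → EuclideanSpace ℝ (Fin n) →L[ℝ] F}
    (hf : Integrable f) (hKK' : ∀ x, HasFDerivAt K (K' x) x) (hK' : Continuous K') {B B' : ℝ}
    (hB : ∀ x, ‖K x‖ ≤ B) (hB' : ∀ x, ‖K' x‖ ≤ B') (x : EuclideanSpace ℝ (Fin n)) :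
    HasFDerivAt (fun y => ∫ z, f z • K (y - z)) (∫ z, f z • K' (x - z)) x := by
  have hK : Continuous K := continuous_iff_continuousAt.2 fun y => (hKK' y).continuousAt
  refine hasFDerivAt_integral_of_dominated_of_fderiv_le (bound := fun z => ‖f z‖ * B')
    (F' := fun y z => f z • K' (y - z))
    univ_mem (Eventually.of_forall fun y => (integrable_smul_comp_sub hf hK hB y).1)
    (integrable_smul_comp_sub hf hK hB x) (integrable_smul_comp_sub hf hK' hB' x).1
    (Eventually.of_forall fun z y _ => ?_) (hf.norm.mul_const B')
    (Eventually.of_forall fun z y _ => ?_)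
  · rw [norm_smul]
    exact mul_le_mul_of_nonneg_left (hB' _) (norm_nonneg _)
  · have h := (hKK' (y - z)).comp y ((hasFDerivAt_id y).sub_const z)
    exact (h.const_smul (f z)).congr_fderiv (by ext; simp)

theorem norm_integral_smul_comp_sub_le_mul_integral [NormedSpace ℝ F] {f : EuclideanSpace ℝ (Fin n) → ℂ}
    {K : EuclideanSpace ℝ (Fin n) → F} (hf : Integrable f) {B : ℝ}
    (hB : ∀ x, ‖K x‖ ≤ B) (x : EuclideanSpace ℝ (Fin n)) :
    ‖∫ z, f z • K (x - z)‖ ≤ B * ∫ z, ‖f z‖ := by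
  rw [← integral_const_mul]
  refine norm_integral_le_of_norm_le (hf.norm.const_mul B) (Eventually.of_forall fun z => ?_)
  rw [norm_smul, mul_comm]
  exact mul_le_mul_of_nonneg_right (hB _) (norm_nonneg _)

/-- The heat kernel has mass one, so a kernel below `B` times it maps the bound `M` to `B * M`.
Unlike the bound by `∫ ‖f‖`, this one does not depend on the support of `f`. -/
theorem norm_integral_smul_comp_sub_le_mul_of_le_heatKernel [NormedSpace ℝ F]
    {f : EuclideanSpace ℝ (Fin n) → ℂ}
    {K : EuclideanSpace ℝ (Fin n) → F} {M B t : ℝ} (ht : 0 < t) (hM : ∀ᵐ z, ‖f z‖ ≤ M)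
    (hB : ∀ x, ‖K x‖ ≤ B * heatKernel t x) (x : EuclideanSpace ℝ (Fin n)) :
    ‖∫ z, f z • K (x - z)‖ ≤ B * M := by
  have hint : Integrable (fun z => B * M * heatKernel t (x - z)) :=
    ((integrable_heatKernel ht).comp_sub_left x).const_mul _
  have hval : ∫ z, B * M * heatKernel t (x - z) = B * M := by
    rw [integral_const_mul, integral_sub_left_eq_self (fun z => heatKernel t z) volume x,
      integral_heatKernel ht, mul_one]
  rw [← hval]
  refine norm_integral_le_of_norm_le hint ?_
  filter_upwards [hM] with z hz
  rw [norm_smul]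
  calc ‖f z‖ * ‖K (x - z)‖ ≤ M * (B * heatKernel t (x - z)) :=
        mul_le_mul hz (hB _) (norm_nonneg _) ((norm_nonneg _).trans hz)
    _ = _ := by ring

end Convolution

/-! ### Smoothing estimates for the heat semigroup. -/

section HeatSemigroup

variable {n : ℕ}

theorem norm_smul_add_smulRight_le {V F : Type*} [NormedAddCommGroup V] [NormedSpace ℝ V]
    [NormedAddCommGroup F] [NormedSpace ℝ F] (c d : ℝ) (L : V →L[ℝ] F) (φ : V →L[ℝ] ℝ) (y : F) :
    ‖c • L + (d • φ).smulRight y‖ ≤ |c| * ‖L‖ + |d| * ‖φ‖ * ‖y‖ := by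
  refine (norm_add_le _ _).trans (le_of_eq ?_)
  rw [norm_smul, ContinuousLinearMap.norm_smulRight_apply, norm_smul, Real.norm_eq_abs,
    Real.norm_eq_abs]

theorem continuous_smul_add_smulRight {X V F : Type*} [TopologicalSpace X] [NormedAddCommGroup V]
    [NormedSpace ℝ V] [NormedAddCommGroup F] [NormedSpace ℝ F] {c d : X → ℝ} (L : V →L[ℝ] F)
    {φ : X → V →L[ℝ] ℝ} {y : X → F} (hc : Continuous c) (hd : Continuous d) (hφ : Continuous φ)
    (hy : Continuous y) : Continuous fun x => c x • L + (d x • φ x).smulRight (y x) := by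
  have h2 : Continuous fun x => ContinuousLinearMap.smulRightL ℝ V F (d x • φ x) (y x) := by
    fun_prop
  have h3 : Continuous fun x => c x • L := by fun_prop
  exact h3.add h2

/-- The inner product as a continuous linear map into the complex-valued functionals. -/
noncomputable def innerCLM (n : ℕ) :
    EuclideanSpace ℝ (Fin n) →L[ℝ] EuclideanSpace ℝ (Fin n) →L[ℝ] ℂ :=
  (ContinuousLinearMap.compL ℝ (EuclideanSpace ℝ (Fin n)) ℝ ℂ Complex.ofRealCLM).comp
    (innerSL ℝ)

theorem norm_innerCLM_apply_le (x : EuclideanSpace ℝ (Fin n)) : ‖innerCLM n x‖ ≤ ‖x‖ := by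
  refine ContinuousLinearMap.opNorm_le_bound _ (norm_nonneg x) fun y => ?_
  simpa [innerCLM] using abs_real_inner_le_norm x y

theorem norm_innerCLM_le : ‖innerCLM n‖ ≤ 1 :=
  ContinuousLinearMap.opNorm_le_bound _ zero_le_one fun x => by
    simpa using norm_innerCLM_apply_le x

/-- The derivative of the heat kernel. -/
noncomputable def heatKernelGrad (t : ℝ) (x : EuclideanSpace ℝ (Fin n)) : EuclideanSpace ℝ (Fin n) →L[ℝ] ℂ :=
  (-(heatKernel t x / (2 * t))) • innerCLM n x

/-- The second derivative of the heat kernel. -/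
noncomputable def heatKernelHess (t : ℝ) (x : EuclideanSpace ℝ (Fin n)) :
    EuclideanSpace ℝ (Fin n) →L[ℝ] EuclideanSpace ℝ (Fin n) →L[ℝ] ℂ :=
  (-(heatKernel t x / (2 * t))) • innerCLM n +
    ((heatKernel t x / (2 * t) ^ 2) • innerSL ℝ x).smulRight (innerCLM n x)

theorem hasFDerivAt_ofReal_heatKernel (t : ℝ) (x : EuclideanSpace ℝ (Fin n)) :
    HasFDerivAt (fun y => (heatKernel t y : ℂ)) (heatKernelGrad t x) x := by
  refine (Complex.ofRealCLM.hasFDerivAt.comp x (hasFDerivAt_heatKernel t x)).congr_fderiv ?_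
  ext y
  simp [heatKernelGrad, innerCLM]

theorem hasFDerivAt_heatKernelGrad (t : ℝ) (x : EuclideanSpace ℝ (Fin n)) :
    HasFDerivAt (heatKernelGrad t) (heatKernelHess t x) x := by
  have h1 : HasFDerivAt (fun y => -(heatKernel t y / (2 * t)))
      ((heatKernel t x / (2 * t) ^ 2) • innerSL ℝ x) x := by
    have := (hasFDerivAt_heatKernel t x).const_smul (-(2 * t)⁻¹)
    refine (this.congr_of_eventuallyEq (Eventually.of_forall fun y => ?_)).congr_fderiv ?_
    · simp [div_eq_inv_mul]
    · ext y; simp; ring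
  exact h1.smul (innerCLM n).hasFDerivAt

theorem continuous_heatKernelGrad (t : ℝ) :
    Continuous (heatKernelGrad t : EuclideanSpace ℝ (Fin n) → _) :=
  continuous_iff_continuousAt.2 fun x => (hasFDerivAt_heatKernelGrad t x).continuousAt

theorem continuous_heatKernelHess (t : ℝ) :
    Continuous (heatKernelHess t : EuclideanSpace ℝ (Fin n) → _) := by
  have h := continuous_heatKernel (n := n) t
  exact continuous_smul_add_smulRight (innerCLM n) (by fun_prop) (by fun_prop)
    (innerSL ℝ).continuous (innerCLM n).continuous

/-- The constant in the bounds of the derivatives of the heat kernel. -/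
noncomputable def heatConst (n : ℕ) : ℝ := 5 * (2 : ℝ) ^ ((n : ℝ) / 2)

theorem heatConst_pos (n : ℕ) : 0 < heatConst n := by unfold heatConst; positivity

theorem norm_heatKernelGrad_le {t : ℝ} (ht : 0 < t) (x : EuclideanSpace ℝ (Fin n)) :
    ‖heatKernelGrad t x‖ ≤ heatConst n * t ^ (-(1 / 2) : ℝ) * heatKernel (2 * t) x := by
  have hG := heatKernel_nonneg ht x
  have hG2 := heatKernel_nonneg (show 0 < 2 * t by positivity) x
  have hs : 0 < Real.sqrt t := Real.sqrt_pos.2 ht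
  have hpow : t ^ (-(1 / 2) : ℝ) = Real.sqrt t / t := by
    rw [Real.rpow_neg ht.le, ← Real.sqrt_eq_rpow, eq_div_iff ht.ne',
      inv_mul_eq_iff_eq_mul₀ hs.ne', Real.mul_self_sqrt ht.le]
  rw [heatKernelGrad, norm_smul, norm_neg, Real.norm_of_nonneg (by positivity), hpow, heatConst]
  calc heatKernel t x / (2 * t) * ‖innerCLM n x‖ ≤ heatKernel t x / (2 * t) * ‖x‖ :=
        mul_le_mul_of_nonneg_left (norm_innerCLM_apply_le x) (by positivity)
    _ = (‖x‖ * heatKernel t x) / (2 * t) := by ring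
    _ ≤ (9 * Real.sqrt t * (2 : ℝ) ^ ((n : ℝ) / 2) * heatKernel (2 * t) x) / (2 * t) :=
        div_le_div_of_nonneg_right (norm_mul_heatKernel_le ht x) (by positivity)
    _ = (9 / 2) * ((2 : ℝ) ^ ((n : ℝ) / 2) * (Real.sqrt t / t) * heatKernel (2 * t) x) := by
        field_simp
    _ ≤ 5 * ((2 : ℝ) ^ ((n : ℝ) / 2) * (Real.sqrt t / t) * heatKernel (2 * t) x) :=
        mul_le_mul_of_nonneg_right (by norm_num) (by positivity)
    _ = _ := by ring

theorem norm_heatKernelHess_le {t : ℝ} (ht : 0 < t) (x : EuclideanSpace ℝ (Fin n)) :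
    ‖heatKernelHess t x‖ ≤ heatConst n * t⁻¹ * heatKernel (2 * t) x := by
  have hG := heatKernel_nonneg ht x
  have hG2 := heatKernel_nonneg (show 0 < 2 * t by positivity) x
  have h1 := norm_smul_add_smulRight_le (-(heatKernel t x / (2 * t))) (heatKernel t x / (2 * t) ^ 2)
    (innerCLM n) (innerSL ℝ x) (innerCLM n x)
  rw [abs_neg, abs_of_nonneg (by positivity), abs_of_nonneg (by positivity),
    innerSL_apply_norm] at h1
  calc ‖heatKernelHess t x‖ ≤ _ := h1
    _ ≤ heatKernel t x / (2 * t) * 1 + heatKernel t x / (2 * t) ^ 2 * ‖x‖ * ‖x‖ :=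
      add_le_add (mul_le_mul_of_nonneg_left norm_innerCLM_le (by positivity))
        (mul_le_mul_of_nonneg_left (norm_innerCLM_apply_le x) (by positivity))
    _ = heatKernel t x / (2 * t) + ‖x‖ ^ 2 * heatKernel t x / (2 * t) ^ 2 := by ring
    _ ≤ ((2 : ℝ) ^ ((n : ℝ) / 2) * heatKernel (2 * t) x) / (2 * t) +
        (8 * t * (2 : ℝ) ^ ((n : ℝ) / 2) * heatKernel (2 * t) x) / (2 * t) ^ 2 :=
      add_le_add (div_le_div_of_nonneg_right (heatKernel_le_two_mul ht x) (by positivity))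
        (div_le_div_of_nonneg_right (norm_sq_mul_heatKernel_le ht x) (by positivity))
    _ = (5 / 2) * ((2 : ℝ) ^ ((n : ℝ) / 2) * t⁻¹ * heatKernel (2 * t) x) := by
        field_simp; ring
    _ ≤ 5 * ((2 : ℝ) ^ ((n : ℝ) / 2) * t⁻¹ * heatKernel (2 * t) x) :=
        mul_le_mul_of_nonneg_right (by norm_num) (by positivity)
    _ = _ := by rw [heatConst]; ring

theorem heatSemigroup_eq (t : ℝ) (f : EuclideanSpace ℝ (Fin n) → ℂ) :
    heatSemigroup t f = fun x => ∫ z, f z • (heatKernel t (x - z) : ℂ) := by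
  funext x
  simp only [heatSemigroup, Complex.real_smul, smul_eq_mul, mul_comm]

theorem norm_ofReal_heatKernel_le {t : ℝ} (ht : 0 < t) (x : EuclideanSpace ℝ (Fin n)) :
    ‖(heatKernel t x : ℂ)‖ ≤ 1 * heatKernel t x := by
  rw [Complex.norm_real, Real.norm_of_nonneg (heatKernel_nonneg ht x), one_mul]

theorem norm_ofReal_heatKernel_le_rpow {t : ℝ} (ht : 0 < t) (x : EuclideanSpace ℝ (Fin n)) :
    ‖(heatKernel t x : ℂ)‖ ≤ (4 * Real.pi * t) ^ (-((n : ℝ) / 2)) :=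
  (norm_ofReal_heatKernel_le ht x).trans (by simpa using heatKernel_le ht x)

/-- The derivative of the heat semigroup in the space variable. -/
noncomputable def heatSemigroupGrad (t : ℝ) (f : EuclideanSpace ℝ (Fin n) → ℂ)
    (x : EuclideanSpace ℝ (Fin n)) : EuclideanSpace ℝ (Fin n) →L[ℝ] ℂ :=
  ∫ z, f z • heatKernelGrad t (x - z)

theorem norm_heatSemigroup_le {t M : ℝ} (ht : 0 < t) {f : EuclideanSpace ℝ (Fin n) → ℂ}
    (hM : ∀ᵐ z, ‖f z‖ ≤ M) (x : EuclideanSpace ℝ (Fin n)) : ‖heatSemigroup t f x‖ ≤ M := by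
  rw [heatSemigroup_eq]
  simpa using norm_integral_smul_comp_sub_le_mul_of_le_heatKernel ht hM
    (norm_ofReal_heatKernel_le ht) x

theorem norm_heatSemigroup_le_integral {t : ℝ} (ht : 0 < t) {f : EuclideanSpace ℝ (Fin n) → ℂ}
    (hf : Integrable f) (x : EuclideanSpace ℝ (Fin n)) :
    ‖heatSemigroup t f x‖ ≤ (4 * Real.pi * t) ^ (-((n : ℝ) / 2)) * ∫ z, ‖f z‖ := by
  rw [heatSemigroup_eq]
  exact norm_integral_smul_comp_sub_le_mul_integral hf (norm_ofReal_heatKernel_le_rpow ht) x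

theorem norm_heatSemigroupGrad_le {t M : ℝ} (ht : 0 < t) {f : EuclideanSpace ℝ (Fin n) → ℂ}
    (hM : ∀ᵐ z, ‖f z‖ ≤ M) (x : EuclideanSpace ℝ (Fin n)) :
    ‖heatSemigroupGrad t f x‖ ≤ heatConst n * M * t ^ (-(1 / 2) : ℝ) := by
  refine (norm_integral_smul_comp_sub_le_mul_of_le_heatKernel (by positivity) hM
    (norm_heatKernelGrad_le ht) x).trans (le_of_eq (by ring))

theorem norm_heatKernelGrad_le_rpow {t : ℝ} (ht : 0 < t) (x : EuclideanSpace ℝ (Fin n)) :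
    ‖heatKernelGrad t x‖ ≤ heatConst n * t ^ (-(1 / 2) : ℝ) *
      (4 * Real.pi * (2 * t)) ^ (-((n : ℝ) / 2)) :=
  (norm_heatKernelGrad_le ht x).trans (mul_le_mul_of_nonneg_left
    (heatKernel_le (by positivity) x) (mul_nonneg (heatConst_pos n).le (by positivity)))

theorem norm_heatSemigroupGrad_le_integral {t : ℝ} (ht : 0 < t)
    {f : EuclideanSpace ℝ (Fin n) → ℂ} (hf : Integrable f) (x : EuclideanSpace ℝ (Fin n)) :
    ‖heatSemigroupGrad t f x‖ ≤ heatConst n * t ^ (-(1 / 2) : ℝ) *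
      (4 * Real.pi * (2 * t)) ^ (-((n : ℝ) / 2)) * ∫ z, ‖f z‖ :=
  norm_integral_smul_comp_sub_le_mul_integral hf (norm_heatKernelGrad_le_rpow ht) x

theorem hasFDerivAt_heatSemigroup {t : ℝ} (ht : 0 < t) {f : EuclideanSpace ℝ (Fin n) → ℂ}
    (hf : Integrable f) (x : EuclideanSpace ℝ (Fin n)) :
    HasFDerivAt (heatSemigroup t f) (heatSemigroupGrad t f x) x := by
  rw [heatSemigroup_eq]
  exact hasFDerivAt_integral_smul_comp_sub hf (hasFDerivAt_ofReal_heatKernel t)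
    (continuous_heatKernelGrad t) (norm_ofReal_heatKernel_le_rpow ht)
    (norm_heatKernelGrad_le_rpow ht) x

theorem norm_heatSemigroupGrad_sub_le {t M : ℝ} (ht : 0 < t)
    {f : EuclideanSpace ℝ (Fin n) → ℂ} (hf : Integrable f) (hM : ∀ᵐ z, ‖f z‖ ≤ M)
    (x y : EuclideanSpace ℝ (Fin n)) :
    ‖heatSemigroupGrad t f y - heatSemigroupGrad t f x‖ ≤ heatConst n * M * t⁻¹ * ‖y - x‖ := by
  have hB : ∀ x : EuclideanSpace ℝ (Fin n), ‖heatKernelHess t x‖ ≤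
      heatConst n * t⁻¹ * (4 * Real.pi * (2 * t)) ^ (-((n : ℝ) / 2)) := fun x =>
    (norm_heatKernelHess_le ht x).trans (mul_le_mul_of_nonneg_left
      (heatKernel_le (by positivity) x) (mul_nonneg (heatConst_pos n).le (by positivity)))
  have hd : ∀ x, HasFDerivAt (heatSemigroupGrad t f) (∫ z, f z • heatKernelHess t (x - z)) x :=
    hasFDerivAt_integral_smul_comp_sub hf (hasFDerivAt_heatKernelGrad t)
      (continuous_heatKernelHess t) (norm_heatKernelGrad_le_rpow ht) hB
  refine Convex.norm_image_sub_le_of_norm_hasFDerivWithin_le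
    (fun z _ => (hd z).hasFDerivWithinAt) (fun z _ => ?_) convex_univ (mem_univ x) (mem_univ y)
  exact (norm_integral_smul_comp_sub_le_mul_of_le_heatKernel (by positivity) hM
    (norm_heatKernelHess_le ht) z).trans (le_of_eq (by ring))

theorem norm_heatSemigroup_sub_le {t M : ℝ} (ht : 0 < t)
    {f : EuclideanSpace ℝ (Fin n) → ℂ} (hf : Integrable f) (hM : ∀ᵐ z, ‖f z‖ ≤ M)
    (x y : EuclideanSpace ℝ (Fin n)) :
    ‖heatSemigroup t f y - heatSemigroup t f x‖ ≤
      heatConst n * M * t ^ (-(1 / 2) : ℝ) * ‖y - x‖ :=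
  Convex.norm_image_sub_le_of_norm_hasFDerivWithin_le
    (fun z _ => (hasFDerivAt_heatSemigroup ht hf z).hasFDerivWithinAt)
    (fun z _ => norm_heatSemigroupGrad_le ht hM z) convex_univ (mem_univ x) (mem_univ y)

theorem norm_heatSemigroup_second_difference_le {t M : ℝ} (ht : 0 < t)
    {f : EuclideanSpace ℝ (Fin n) → ℂ} (hf : Integrable f) (hM : ∀ᵐ z, ‖f z‖ ≤ M)
    (x h : EuclideanSpace ℝ (Fin n)) :
    ‖heatSemigroup t f (x + h) + heatSemigroup t f (x - h) - 2 * heatSemigroup t f x‖ ≤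
      2 * heatConst n * M * t⁻¹ * ‖h‖ ^ 2 := by
  obtain ⟨z, hz⟩ := hM.exists
  have hM0 : 0 ≤ M := (norm_nonneg _).trans hz
  -- Symmetrising in `y` makes the gradient a difference of gradients at distance `2‖y‖`. Its
  -- Lipschitz bound and the mean value inequality from `0` to `h` yield two powers of `‖h‖`.
  have hd : ∀ y, HasFDerivAt (fun y => heatSemigroup t f (x + y) + heatSemigroup t f (x - y))
      (heatSemigroupGrad t f (x + y) - heatSemigroupGrad t f (x - y)) y := by
    intro y
    have h1 := (hasFDerivAt_heatSemigroup ht hf (x + y)).comp y ((hasFDerivAt_id y).const_add x)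
    have h2 := (hasFDerivAt_heatSemigroup ht hf (x - y)).comp y ((hasFDerivAt_id y).const_sub x)
    refine (h1.add h2).congr_fderiv ?_
    ext v
    simp [sub_eq_add_neg]
  have hball := (convex_closedBall (0 : EuclideanSpace ℝ (Fin n)) ‖h‖)
  have key := Convex.norm_image_sub_le_of_norm_hasFDerivWithin_le
    (C := 2 * heatConst n * M * t⁻¹ * ‖h‖)
    (fun z _ => (hd z).hasFDerivWithinAt) (fun z hz => ?_) hball
    (Metric.mem_closedBall_self (norm_nonneg h)) (mem_closedBall_zero_iff.2 le_rfl)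
  · have e : heatSemigroup t f (x + h) + heatSemigroup t f (x - h) - 2 * heatSemigroup t f x =
        heatSemigroup t f (x + h) + heatSemigroup t f (x - h) -
          (heatSemigroup t f (x + 0) + heatSemigroup t f (x - 0)) := by
      simp; ring
    rw [e]
    exact key.trans (le_of_eq (by rw [sub_zero]; ring))
  · refine (norm_heatSemigroupGrad_sub_le ht hf hM _ _).trans ?_
    have hz' : ‖z‖ ≤ ‖h‖ := mem_closedBall_zero_iff.1 hz
    have e : x + z - (x - z) = (2 : ℝ) • z := by rw [two_smul]; abel
    rw [e, norm_smul, Real.norm_two]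
    have hc := heatConst_pos n
    calc heatConst n * M * t⁻¹ * (2 * ‖z‖) ≤ heatConst n * M * t⁻¹ * (2 * ‖h‖) := by gcongr
      _ = _ := by ring

end HeatSemigroup

/-! ### Integrals over `(0, ∞)` under two competing power bounds. -/

section PowerIntegrals

variable {F : Type*} [NormedAddCommGroup F]

theorem integrableOn_Ioc_zero_rpow {p T : ℝ} (hp : -1 < p) (hT : 0 < T) :
    IntegrableOn (fun t : ℝ => t ^ p) (Ioc 0 T) :=
  (intervalIntegrable_iff_integrableOn_Ioc_of_le hT.le).1
    (intervalIntegral.intervalIntegrable_rpow' hp)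

theorem integral_Ioc_zero_rpow {p T : ℝ} (hp : -1 < p) (hT : 0 < T) :
    ∫ t in Ioc 0 T, t ^ p = T ^ (p + 1) / (p + 1) := by
  rw [← intervalIntegral.integral_of_le hT.le, integral_rpow (Or.inl hp),
    Real.zero_rpow (by linarith), sub_zero]

theorem integrableOn_Ioi_of_norm_le_rpow {G : ℝ → F} {A B p q : ℝ}
    (hG : AEStronglyMeasurable G (volume.restrict (Ioi 0)))
    (hp : -1 < p) (hq : q < -1) (hA : ∀ t > 0, ‖G t‖ ≤ A * t ^ p)
    (hB : ∀ t > 0, ‖G t‖ ≤ B * t ^ q) : IntegrableOn G (Ioi 0) := by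
  rw [← Ioc_union_Ioi_eq_Ioi (zero_le_one (α := ℝ))]
  refine IntegrableOn.union ?_ ?_
  · refine Integrable.mono' ((integrableOn_Ioc_zero_rpow hp one_pos).const_mul A)
      (hG.mono_set Ioc_subset_Ioi_self) ?_
    filter_upwards [ae_restrict_mem measurableSet_Ioc] with t ht using hA t ht.1
  · refine Integrable.mono' ((integrableOn_Ioi_rpow_of_lt hq one_pos).const_mul B)
      (hG.mono_set (Ioi_subset_Ioi zero_le_one)) ?_
    filter_upwards [ae_restrict_mem measurableSet_Ioi] with t ht using hB t (one_pos.trans ht)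

/-- The cut `T` is free: the first bound is integrated up to `T` and the second beyond it. The
regularity estimates take for `T` the square of the step. -/
theorem norm_integral_Ioi_le_of_norm_le_rpow [NormedSpace ℝ F] {G : ℝ → F} {A B p q T : ℝ}
    (hG : AEStronglyMeasurable G (volume.restrict (Ioi 0)))
    (hp : -1 < p) (hq : q < -1) (hA : ∀ t > 0, ‖G t‖ ≤ A * t ^ p)
    (hB : ∀ t > 0, ‖G t‖ ≤ B * t ^ q) (hT : 0 < T) :
    ‖∫ t in Ioi 0, G t‖ ≤ A * (T ^ (p + 1) / (p + 1)) + B * (-T ^ (q + 1) / (q + 1)) := by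
  have hint := integrableOn_Ioi_of_norm_le_rpow hG hp hq hA hB
  rw [← Ioc_union_Ioi_eq_Ioi hT.le] at hint ⊢
  rw [setIntegral_union (Ioc_disjoint_Ioi le_rfl) measurableSet_Ioi hint.left_of_union
    hint.right_of_union]
  refine (norm_add_le _ _).trans (add_le_add ?_ ?_)
  · rw [← integral_Ioc_zero_rpow hp hT, ← integral_const_mul]
    refine norm_integral_le_of_norm_le ((integrableOn_Ioc_zero_rpow hp hT).const_mul A) ?_
    filter_upwards [ae_restrict_mem measurableSet_Ioc] with t ht using hA t ht.1
  · rw [← integral_Ioi_rpow_of_lt hq hT, ← integral_const_mul]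
    refine norm_integral_le_of_norm_le ((integrableOn_Ioi_rpow_of_lt hq hT).const_mul B) ?_
    filter_upwards [ae_restrict_mem measurableSet_Ioi] with t ht using hB t (hT.trans ht)

theorem integrableOn_min_rpow {A B p q : ℝ} (hA : 0 ≤ A) (hB : 0 ≤ B)
    (hp : -1 < p) (hq : q < -1) :
    IntegrableOn (fun t : ℝ => min (A * t ^ p) (B * t ^ q)) (Ioi 0) := by
  have hpos : ∀ t > (0 : ℝ), 0 ≤ min (A * t ^ p) (B * t ^ q) := fun t ht => by positivity
  refine integrableOn_Ioi_of_norm_le_rpow (A := A) (B := B)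
    (Measurable.aestronglyMeasurable (by fun_prop)) hp hq (fun t ht => ?_) (fun t ht => ?_)
  · rw [Real.norm_of_nonneg (hpos t ht)]; exact min_le_left _ _
  · rw [Real.norm_of_nonneg (hpos t ht)]; exact min_le_right _ _

theorem sq_rpow_eq {h : ℝ} (hh : 0 ≤ h) (a : ℝ) : (h ^ 2) ^ a = h ^ (2 * a) := by
  rw [← Real.rpow_natCast_mul hh]; norm_num

end PowerIntegrals

/-! ### Joint measurability in time and space. -/

section Measurability

variable {n : ℕ}

theorem stronglyMeasurable_integral_smul_sub {F : Type*} [NormedAddCommGroup F]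
    [NormedSpace ℝ F] [NormedSpace ℂ F] {f : EuclideanSpace ℝ (Fin n) → ℂ}
    (hf : AEStronglyMeasurable f) {K : ℝ → EuclideanSpace ℝ (Fin n) → F}
    (hK : StronglyMeasurable (Function.uncurry K)) :
    StronglyMeasurable fun p : ℝ × EuclideanSpace ℝ (Fin n) => ∫ z, f z • K p.1 (p.2 - z) := by
  -- Passing to a measurable representative of `f` changes none of the integrals, so the
  -- measurability obtained is strong, not only almost everywhere.
  have e : (fun p : ℝ × EuclideanSpace ℝ (Fin n) => ∫ z, f z • K p.1 (p.2 - z)) =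
      fun p => ∫ z, hf.mk f z • K p.1 (p.2 - z) := by
    funext p
    refine integral_congr_ae ?_
    filter_upwards [hf.ae_eq_mk] with z hz
    rw [hz]
  rw [e]
  refine StronglyMeasurable.integral_prod_right ?_
  have h1 : StronglyMeasurable fun q : (ℝ × EuclideanSpace ℝ (Fin n)) × EuclideanSpace ℝ (Fin n) =>
      hf.mk f q.2 := hf.stronglyMeasurable_mk.comp_measurable measurable_snd
  have h2 : StronglyMeasurable fun q : (ℝ × EuclideanSpace ℝ (Fin n)) × EuclideanSpace ℝ (Fin n) =>
      K q.1.1 (q.1.2 - q.2) :=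
    hK.comp_measurable (measurable_fst.fst.prodMk (measurable_fst.snd.sub measurable_snd))
  exact h1.smul h2

theorem stronglyMeasurable_heatSemigroup {f : EuclideanSpace ℝ (Fin n) → ℂ}
    (hf : AEStronglyMeasurable f) :
    StronglyMeasurable fun p : ℝ × EuclideanSpace ℝ (Fin n) => heatSemigroup p.1 f p.2 := by
  simp_rw [heatSemigroup_eq]
  exact stronglyMeasurable_integral_smul_sub hf (K := fun t x => (heatKernel t x : ℂ))
    (Complex.measurable_ofReal.comp measurable_heatKernel_uncurry).stronglyMeasurable

theorem stronglyMeasurable_heatSemigroupGrad {f : EuclideanSpace ℝ (Fin n) → ℂ}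
    (hf : AEStronglyMeasurable f) :
    StronglyMeasurable fun p : ℝ × EuclideanSpace ℝ (Fin n) => heatSemigroupGrad p.1 f p.2 := by
  refine stronglyMeasurable_integral_smul_sub hf (K := heatKernelGrad) ?_
  have h1 : StronglyMeasurable fun q : ℝ × EuclideanSpace ℝ (Fin n) =>
      -(heatKernel q.1 q.2 / (2 * q.1)) := by
    refine Measurable.stronglyMeasurable ?_
    exact (measurable_heatKernel_uncurry.div (measurable_fst.const_mul 2)).neg
  exact h1.smul ((innerCLM n).continuous.comp continuous_snd).stronglyMeasurable

theorem stronglyMeasurable_rpow_smul_heatSemigroup {f : EuclideanSpace ℝ (Fin n) → ℂ}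
    (hf : AEStronglyMeasurable f) (a : ℝ) :
    StronglyMeasurable fun p : ℝ × EuclideanSpace ℝ (Fin n) =>
      p.1 ^ a • heatSemigroup p.1 f p.2 :=
  (measurable_fst.pow_const a).stronglyMeasurable.smul (stronglyMeasurable_heatSemigroup hf)

theorem stronglyMeasurable_rpow_smul_heatSemigroup_left {f : EuclideanSpace ℝ (Fin n) → ℂ}
    (hf : AEStronglyMeasurable f) (a : ℝ) (x : EuclideanSpace ℝ (Fin n)) :
    StronglyMeasurable fun t : ℝ => t ^ a • heatSemigroup t f x :=
  (stronglyMeasurable_rpow_smul_heatSemigroup hf a).comp_measurable measurable_prodMk_right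

theorem stronglyMeasurable_rpow_smul {F : Type*} [NormedAddCommGroup F] [NormedSpace ℝ F]
    {g : ℝ → F} (hg : StronglyMeasurable g) (a : ℝ) : StronglyMeasurable fun t => t ^ a • g t :=
  (measurable_id.pow_const a).stronglyMeasurable.smul hg

theorem stronglyMeasurable_rpow_smul_heatSemigroupGrad_left {f : EuclideanSpace ℝ (Fin n) → ℂ}
    (hf : AEStronglyMeasurable f) (a : ℝ) (x : EuclideanSpace ℝ (Fin n)) :
    StronglyMeasurable fun t : ℝ => t ^ a • heatSemigroupGrad t f x :=
  stronglyMeasurable_rpow_smul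
    ((stronglyMeasurable_heatSemigroupGrad hf).comp_measurable measurable_prodMk_right) a

end Measurability

/-! ### Hölder, Zygmund and gradient estimates for the potential. -/

section Regularity

variable {n : ℕ} {f : EuclideanSpace ℝ (Fin n) → ℂ} {M s : ℝ}

theorem norm_rpow_smul_le {F : Type*} [NormedAddCommGroup F] [NormedSpace ℝ F] {v : F}
    {t a b A : ℝ} (ht : 0 < t) (hv : ‖v‖ ≤ A * t ^ b) : ‖t ^ a • v‖ ≤ A * t ^ (a + b) := by
  rw [norm_smul, Real.norm_of_nonneg (by positivity), Real.rpow_add ht]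
  calc t ^ a * ‖v‖ ≤ t ^ a * (A * t ^ b) := by gcongr
    _ = _ := by ring

theorem norm_rpow_smul_heatSemigroup_le (hM : ∀ᵐ z, ‖f z‖ ≤ M) (x : EuclideanSpace ℝ (Fin n)) :
    ∀ t > 0, ‖t ^ (s - 1) • heatSemigroup t f x‖ ≤ M * t ^ (s - 1) := fun t ht => by
  have h := norm_rpow_smul_le (a := s - 1) (b := 0) ht
    ((norm_heatSemigroup_le ht hM x).trans_eq (by rw [Real.rpow_zero, mul_one]))
  rwa [add_zero] at h

theorem norm_rpow_smul_heatSemigroup_le_integral (hf : Integrable f)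
    (x : EuclideanSpace ℝ (Fin n)) :
    ∀ t > 0, ‖t ^ (s - 1) • heatSemigroup t f x‖ ≤
      ((4 * Real.pi) ^ (-((n : ℝ) / 2)) * ∫ z, ‖f z‖) * t ^ (s - 1 + -((n : ℝ) / 2)) :=
  fun t ht => norm_rpow_smul_le ht <| (norm_heatSemigroup_le_integral ht hf x).trans <|
    le_of_eq (by rw [Real.mul_rpow (by positivity) ht.le]; ring)

/-- Near 0 the bound `M t^{s-1}` is integrable because `s > 0`; at infinity `t^{s-1-n/2}` is,
because `s < n/2`. -/
theorem integrableOn_rpow_smul_heatSemigroup (hs0 : 0 < s) (hsn : s < (n : ℝ) / 2)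
    (hf : Integrable f) (hM : ∀ᵐ z, ‖f z‖ ≤ M) (x : EuclideanSpace ℝ (Fin n)) :
    IntegrableOn (fun t : ℝ => t ^ (s - 1) • heatSemigroup t f x) (Ioi 0) :=
  integrableOn_Ioi_of_norm_le_rpow
    (stronglyMeasurable_rpow_smul_heatSemigroup_left hf.1 _ x).aestronglyMeasurable
    (by linarith) (by linarith) (norm_rpow_smul_heatSemigroup_le hM x)
    (norm_rpow_smul_heatSemigroup_le_integral hf x)

theorem norm_one_div_Gamma_smul {F : Type*} [NormedAddCommGroup F] [NormedSpace ℝ F]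
    (hs0 : 0 < s) (v : F) : ‖(1 / Real.Gamma s) • v‖ = 1 / Real.Gamma s * ‖v‖ := by
  have := Real.Gamma_pos_of_pos hs0
  rw [norm_smul, Real.norm_of_nonneg (by positivity)]

theorem norm_smul_integral_sub {F : Type*} [NormedAddCommGroup F] [NormedSpace ℝ F]
    (hs0 : 0 < s) {a b : ℝ → F} {S : Set ℝ} (ha : IntegrableOn a S) (hb : IntegrableOn b S) :
    ‖((1 / Real.Gamma s) • ∫ t in S, a t) - (1 / Real.Gamma s) • ∫ t in S, b t‖ =
      1 / Real.Gamma s * ‖∫ t in S, (a - b) t‖ := by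
  rw [← smul_sub, ← integral_sub' ha hb, norm_one_div_Gamma_smul hs0]

theorem norm_rpow_smul_sub_rpow_smul_le {F : Type*} [NormedAddCommGroup F] [NormedSpace ℝ F]
    {v w : F} {t a b A : ℝ} (ht : 0 < t) (hv : ‖v - w‖ ≤ A * t ^ b) :
    ‖t ^ a • v - t ^ a • w‖ ≤ A * t ^ (a + b) := by
  rw [← smul_sub]
  exact norm_rpow_smul_le ht hv

/-- The constant in the Hölder estimate of order `2s < 1`. -/
noncomputable def holderConst (n : ℕ) (s : ℝ) : ℝ :=
  1 / Real.Gamma s * (2 / s + heatConst n / (1 / 2 - s))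

theorem norm_invFracLaplacian_sub_le (hs0 : 0 < s) (hs : 2 * s < 1) (hsn : s < (n : ℝ) / 2)
    (hf : Integrable f) (hM : ∀ᵐ z, ‖f z‖ ≤ M) (x y : EuclideanSpace ℝ (Fin n)) :
    ‖invFracLaplacian s f y - invFracLaplacian s f x‖ ≤
      holderConst n s * M * ‖y - x‖ ^ (2 * s) := by
  rcases eq_or_ne y x with rfl | hne
  · simp [Real.zero_rpow (show 2 * s ≠ 0 by linarith)]
  have hh : 0 < ‖y - x‖ := norm_pos_iff.2 (sub_ne_zero.2 hne)
  have hx := integrableOn_rpow_smul_heatSemigroup hs0 hsn hf hM x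
  have hy := integrableOn_rpow_smul_heatSemigroup hs0 hsn hf hM y
  rw [invFracLaplacian, invFracLaplacian, norm_smul_integral_sub hs0 hy hx,
    holderConst, mul_assoc, mul_assoc]
  have hΓ := Real.Gamma_pos_of_pos hs0
  refine mul_le_mul_of_nonneg_left ?_ (by positivity)
  -- Cut at the parabolic scale. The tail exponent `s - 3/2` is below `-1` exactly when `2s < 1`.
  have key := norm_integral_Ioi_le_of_norm_le_rpow (A := 2 * M) (B := heatConst n * M * ‖y - x‖)
    (p := s - 1) (q := s - 1 + -(1 / 2)) (T := ‖y - x‖ ^ 2) (hy.1.sub hx.1)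
    (by linarith) (by linarith) (fun t ht => ?_) (fun t ht => ?_) (by positivity)
  · refine key.trans (le_of_eq ?_)
    rw [sq_rpow_eq hh.le, sq_rpow_eq hh.le]
    have e1 : 2 * (s - 1 + 1) = 2 * s := by ring
    have e2 : 2 * (s - 1 + -(1 / 2) + 1) = 2 * s - 1 := by ring
    have e3 : s - 1 + -(1 / 2) + 1 = -(1 / 2 - s) := by ring
    have e4 : s - 1 + 1 = s := by ring
    rw [e1, e2, e3, e4, Real.rpow_sub hh, Real.rpow_one]
    have : 1 / 2 - s ≠ 0 := by linarith
    field_simp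
  · refine (norm_sub_le _ _).trans ?_
    have h1 := norm_rpow_smul_heatSemigroup_le (s := s) hM x t ht
    have h2 := norm_rpow_smul_heatSemigroup_le (s := s) hM y t ht
    linarith
  · exact norm_rpow_smul_sub_rpow_smul_le ht
      ((norm_heatSemigroup_sub_le ht hf hM x y).trans (le_of_eq (by ring)))

/-- The constant in the Zygmund estimate of order `2s < 2`. -/
noncomputable def zygmundConst (n : ℕ) (s : ℝ) : ℝ :=
  1 / Real.Gamma s * (4 / s + 2 * heatConst n / (1 - s))

theorem norm_invFracLaplacian_second_difference_le (hs0 : 0 < s) (hs1 : s < 1)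
    (hsn : s < (n : ℝ) / 2) (hf : Integrable f) (hM : ∀ᵐ z, ‖f z‖ ≤ M)
    (x : EuclideanSpace ℝ (Fin n)) {h : EuclideanSpace ℝ (Fin n)} (hne : h ≠ 0) :
    ‖invFracLaplacian s f (x + h) + invFracLaplacian s f (x - h) - 2 * invFracLaplacian s f x‖ ≤
      zygmundConst n s * M * ‖h‖ ^ (2 * s) := by
  have hh : 0 < ‖h‖ := norm_pos_iff.2 hne
  have hx := integrableOn_rpow_smul_heatSemigroup hs0 hsn hf hM x
  have h1 := integrableOn_rpow_smul_heatSemigroup hs0 hsn hf hM (x + h)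
  have h2 := integrableOn_rpow_smul_heatSemigroup hs0 hsn hf hM (x - h)
  have e0 : invFracLaplacian s f (x + h) + invFracLaplacian s f (x - h) -
      2 * invFracLaplacian s f x = (1 / Real.Gamma s) • ∫ t in Ioi 0,
        (t ^ (s - 1) • heatSemigroup t f (x + h) + t ^ (s - 1) • heatSemigroup t f (x - h) -
          2 * (t ^ (s - 1) • heatSemigroup t f x)) := by
    have e := integral_sub (h1.add h2) (hx.const_mul 2)
    rw [integral_add' h1 h2, integral_const_mul] at e
    refine Eq.trans ?_ (congrArg ((1 / Real.Gamma s) • ·) e.symm)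
    simp only [invFracLaplacian, smul_add, smul_sub, mul_smul_comm]
  rw [e0, norm_one_div_Gamma_smul hs0, zygmundConst, mul_assoc, mul_assoc]
  have hΓ := Real.Gamma_pos_of_pos hs0
  refine mul_le_mul_of_nonneg_left ?_ (by positivity)
  -- The second difference has total weight `1 + 1 + 2 = 4`. Its decay `t⁻¹` gives the tail exponent
  -- `s - 2`, below `-1` for every `s < 1`; the borderline `2s = 1` is therefore covered.
  have key := norm_integral_Ioi_le_of_norm_le_rpow (A := 4 * M)
    (B := 2 * heatConst n * M * ‖h‖ ^ 2)
    (p := s - 1) (q := s - 1 + -1) (T := ‖h‖ ^ 2) ((h1.add h2).sub (hx.const_mul 2)).1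
    (by linarith) (by linarith) (fun t ht => ?_) (fun t ht => ?_) (by positivity)
  · refine key.trans (le_of_eq ?_)
    rw [sq_rpow_eq hh.le, sq_rpow_eq hh.le]
    have e1 : 2 * (s - 1 + 1) = 2 * s := by ring
    have e2 : 2 * (s - 1 + -1 + 1) = 2 * s - 2 := by ring
    have e3 : s - 1 + -1 + 1 = -(1 - s) := by ring
    have e4 : s - 1 + 1 = s := by ring
    rw [e1, e2, e3, e4, Real.rpow_sub hh, Real.rpow_two]
    have : 1 - s ≠ 0 := by linarith
    field_simp
  · refine (norm_sub_le _ _).trans ((add_le_add (norm_add_le _ _) le_rfl).trans ?_)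
    have b1 := norm_rpow_smul_heatSemigroup_le (s := s) hM x t ht
    have b2 := norm_rpow_smul_heatSemigroup_le (s := s) hM (x + h) t ht
    have b3 := norm_rpow_smul_heatSemigroup_le (s := s) hM (x - h) t ht
    rw [norm_mul, Complex.norm_two]
    linarith
  · have e5 : ((fun t : ℝ => t ^ (s - 1) • heatSemigroup t f (x + h)) +
        fun t => t ^ (s - 1) • heatSemigroup t f (x - h)) t -
          2 * (t ^ (s - 1) • heatSemigroup t f x) = t ^ (s - 1) • (heatSemigroup t f (x + h) +
        heatSemigroup t f (x - h) - 2 * heatSemigroup t f x) := by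
      simp only [Pi.add_apply, smul_add, smul_sub, mul_smul_comm]
    refine (congrArg norm e5).trans_le ?_
    refine norm_rpow_smul_le ht
      ((norm_heatSemigroup_second_difference_le ht hf hM x h).trans (le_of_eq ?_))
    rw [Real.rpow_neg_one]; ring

/-- The derivative of `(-Δ)^{-s} f` for `2s > 1`. -/
noncomputable def invFracLaplacianGrad (s : ℝ) (f : EuclideanSpace ℝ (Fin n) → ℂ)
    (x : EuclideanSpace ℝ (Fin n)) : EuclideanSpace ℝ (Fin n) →L[ℝ] ℂ :=
  (1 / Real.Gamma s) • ∫ t in Ioi (0 : ℝ), t ^ (s - 1) • heatSemigroupGrad t f x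

theorem norm_rpow_smul_heatSemigroupGrad_le (hM : ∀ᵐ z, ‖f z‖ ≤ M)
    (x : EuclideanSpace ℝ (Fin n)) :
    ∀ t > 0, ‖t ^ (s - 1) • heatSemigroupGrad t f x‖ ≤
      heatConst n * M * t ^ (s - 1 + -(1 / 2)) := fun _ ht =>
  norm_rpow_smul_le ht (norm_heatSemigroupGrad_le ht hM x)

theorem norm_rpow_smul_heatSemigroupGrad_le_integral (hf : Integrable f)
    (x : EuclideanSpace ℝ (Fin n)) :
    ∀ t > 0, ‖t ^ (s - 1) • heatSemigroupGrad t f x‖ ≤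
      (heatConst n * (4 * Real.pi * 2) ^ (-((n : ℝ) / 2)) * ∫ z, ‖f z‖) *
        t ^ (s - 1 + (-(1 / 2) + -((n : ℝ) / 2))) := fun t ht =>
  norm_rpow_smul_le ht <| (norm_heatSemigroupGrad_le_integral ht hf x).trans <| le_of_eq <| by
    rw [← mul_assoc (4 * Real.pi), Real.mul_rpow (by positivity) ht.le, Real.rpow_add ht]; ring

theorem integrableOn_rpow_smul_heatSemigroupGrad (hs : 1 < 2 * s) (hsn : s < (n : ℝ) / 2)
    (hf : Integrable f) (hM : ∀ᵐ z, ‖f z‖ ≤ M) (x : EuclideanSpace ℝ (Fin n)) :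
    IntegrableOn (fun t : ℝ => t ^ (s - 1) • heatSemigroupGrad t f x) (Ioi 0) :=
  integrableOn_Ioi_of_norm_le_rpow
    (stronglyMeasurable_rpow_smul_heatSemigroupGrad_left hf.1 _ x).aestronglyMeasurable
    (by linarith) (by linarith) (norm_rpow_smul_heatSemigroupGrad_le hM x)
    (norm_rpow_smul_heatSemigroupGrad_le_integral hf x)

/-- Differentiation under the integral over `t`: the condition `2s > 1` makes the gradient bound
`t^{s-3/2}` integrable at 0, and the bound by `∫ ‖f‖` controls large `t`. The minimum of the two
dominates uniformly in `x`. -/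
theorem hasFDerivAt_invFracLaplacian (hs0 : 0 < s) (hs : 1 < 2 * s) (hsn : s < (n : ℝ) / 2)
    (hf : Integrable f) (hM : ∀ᵐ z, ‖f z‖ ≤ M) (x : EuclideanSpace ℝ (Fin n)) :
    HasFDerivAt (invFracLaplacian s f) (invFracLaplacianGrad s f x) x := by
  obtain ⟨z, hz⟩ := hM.exists
  have hM0 : 0 ≤ M := (norm_nonneg _).trans hz
  have hc := heatConst_pos n
  have hI : 0 ≤ ∫ z, ‖f z‖ := integral_nonneg fun _ => norm_nonneg _
  refine HasFDerivAt.const_smul ?_ (1 / Real.Gamma s)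
  refine hasFDerivAt_integral_of_dominated_of_fderiv_le
    (F' := fun y t => t ^ (s - 1) • heatSemigroupGrad t f y)
    (bound := fun t => min (heatConst n * M * t ^ (s - 1 + -(1 / 2)))
      ((heatConst n * (4 * Real.pi * 2) ^ (-((n : ℝ) / 2)) * ∫ z, ‖f z‖) *
        t ^ (s - 1 + (-(1 / 2) + -((n : ℝ) / 2))))) univ_mem
    (Eventually.of_forall fun y =>
      (integrableOn_rpow_smul_heatSemigroup hs0 hsn hf hM y).1)
    (integrableOn_rpow_smul_heatSemigroup hs0 hsn hf hM x)
    (integrableOn_rpow_smul_heatSemigroupGrad hs hsn hf hM x).1 ?_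
    (integrableOn_min_rpow (by positivity) (by positivity) (by linarith) (by linarith)) ?_
  · filter_upwards [ae_restrict_mem measurableSet_Ioi] with t ht y _
    exact le_min (norm_rpow_smul_heatSemigroupGrad_le hM y t ht)
      (norm_rpow_smul_heatSemigroupGrad_le_integral hf y t ht)
  · filter_upwards [ae_restrict_mem measurableSet_Ioi] with t ht y _
    exact (hasFDerivAt_heatSemigroup ht hf y).const_smul (t ^ (s - 1))

/-- The constant in the Hölder estimate of order `2s - 1` for the derivative. -/
noncomputable def holderGradConst (n : ℕ) (s : ℝ) : ℝ :=
  1 / Real.Gamma s * (2 * heatConst n / (s - 1 / 2) + heatConst n / (1 - s))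

theorem norm_invFracLaplacianGrad_sub_le (hs1 : s < 1) (hs : 1 < 2 * s) (hsn : s < (n : ℝ) / 2)
    (hf : Integrable f) (hM : ∀ᵐ z, ‖f z‖ ≤ M) (x y : EuclideanSpace ℝ (Fin n)) :
    ‖invFracLaplacianGrad s f y - invFracLaplacianGrad s f x‖ ≤
      holderGradConst n s * M * ‖y - x‖ ^ (2 * s - 1) := by
  rcases eq_or_ne y x with rfl | hne
  · simp [Real.zero_rpow (show 2 * s - 1 ≠ 0 by linarith)]
  have hs0 : 0 < s := by linarith
  have hh : 0 < ‖y - x‖ := norm_pos_iff.2 (sub_ne_zero.2 hne)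
  have hx := integrableOn_rpow_smul_heatSemigroupGrad hs hsn hf hM x
  have hy := integrableOn_rpow_smul_heatSemigroupGrad hs hsn hf hM y
  rw [invFracLaplacianGrad, invFracLaplacianGrad, norm_smul_integral_sub hs0 hy hx,
    holderGradConst, mul_assoc, mul_assoc]
  have hΓ := Real.Gamma_pos_of_pos hs0
  refine mul_le_mul_of_nonneg_left ?_ (by positivity)
  -- The same cut one derivative higher: `t^{s-3/2}` from the size of the gradients, `t^{s-2}` from
  -- their Lipschitz bound.
  have key := norm_integral_Ioi_le_of_norm_le_rpow (A := 2 * (heatConst n * M))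
    (B := heatConst n * M * ‖y - x‖)
    (p := s - 1 + -(1 / 2)) (q := s - 1 + -1) (T := ‖y - x‖ ^ 2) (hy.1.sub hx.1)
    (by linarith) (by linarith) (fun t ht => ?_) (fun t ht => ?_) (by positivity)
  · refine key.trans (le_of_eq ?_)
    rw [sq_rpow_eq hh.le, sq_rpow_eq hh.le]
    have e1 : 2 * (s - 1 + -(1 / 2) + 1) = 2 * s - 1 := by ring
    have e2 : 2 * (s - 1 + -1 + 1) = 2 * s - 1 - 1 := by ring
    have e3 : s - 1 + -1 + 1 = -(1 - s) := by ring
    have e4 : s - 1 + -(1 / 2) + 1 = s - 1 / 2 := by ring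
    rw [e1, e2, e3, e4, Real.rpow_sub hh (2 * s - 1) 1, Real.rpow_one]
    have h1 : 1 - s ≠ 0 := by linarith
    have h2 : s - 1 / 2 ≠ 0 := by linarith
    field_simp
  · refine (norm_sub_le _ _).trans ?_
    have h1 := norm_rpow_smul_heatSemigroupGrad_le (s := s) hM x t ht
    have h2 := norm_rpow_smul_heatSemigroupGrad_le (s := s) hM y t ht
    linarith
  · refine norm_rpow_smul_sub_rpow_smul_le ht
      ((norm_heatSemigroupGrad_sub_le ht hf hM x y).trans (le_of_eq ?_))
    rw [Real.rpow_neg_one]; ring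

/-- Interpolation: a function with a Hölder continuous derivative has a bounded derivative if it
is bounded. -/
theorem norm_le_of_hasFDerivAt_of_holder {E F : Type*} [NormedAddCommGroup E] [NormedSpace ℝ E]
    [NormedAddCommGroup F] [NormedSpace ℝ F] {u : E → F} {u' : E → E →L[ℝ] F} {S H a : ℝ}
    (hu : ∀ x, HasFDerivAt u (u' x) x) (hS : ∀ x, ‖u x‖ ≤ S) (hH0 : 0 ≤ H) (ha : 0 ≤ a)
    (hH : ∀ x y, ‖u' y - u' x‖ ≤ H * ‖y - x‖ ^ a) (x : E) : ‖u' x‖ ≤ 2 * S + H := by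
  have hS0 : 0 ≤ S := (norm_nonneg _).trans (hS x)
  refine ContinuousLinearMap.opNorm_le_of_unit_norm (by positivity) fun h hh => ?_
  have key := Convex.norm_image_sub_le_of_norm_hasFDerivWithin_le' (f := u) (f' := u') (C := H)
    (φ := u' x) (x := x) (y := x + h)
    (fun z _ => (hu z).hasFDerivWithinAt) ?_ (convex_closedBall x 1)
    (Metric.mem_closedBall_self zero_le_one) (by simp [hh])
  · rw [add_sub_cancel_left, hh, mul_one] at key
    -- Over a unit step, the derivative is the increment of `u`, at most `2S`, minus a Taylor error
    -- of at most `H`.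
    have e : u' x h = u (x + h) - u x - (u (x + h) - u x - u' x h) := by abel
    rw [e]
    refine (norm_sub_le _ _).trans (add_le_add ((norm_sub_le _ _).trans ?_) key)
    linarith [hS x, hS (x + h)]
  · intro z hz
    refine (hH x z).trans (mul_le_of_le_one_right hH0 ?_)
    exact Real.rpow_le_one (norm_nonneg _) (by simpa [dist_eq_norm] using hz) ha

end Regularity

/-! ### Boundedness, continuity and decay at infinity. -/

section Decay

variable {n : ℕ} {f : EuclideanSpace ℝ (Fin n) → ℂ} {M s : ℝ}

/-- Dominated convergence along a filter requires the filter to be countably generated; this allows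
limits as `|x| → ∞`. -/
instance isCountablyGenerated_cocompact_euclideanSpace :
    IsCountablyGenerated (cocompact (EuclideanSpace ℝ (Fin n))) := by
  rw [← Metric.cobounded_eq_cocompact, ← comap_norm_atTop]
  infer_instance

theorem tendsto_heatKernel_cocompact {t : ℝ} (ht : 0 < t) :
    Tendsto (heatKernel t) (cocompact (EuclideanSpace ℝ (Fin n))) (𝓝 0) := by
  have h1 : Tendsto (fun x : EuclideanSpace ℝ (Fin n) => -‖x‖ ^ 2 / (4 * t)) (cocompact _) atBot := by
    have h := ((tendsto_pow_atTop two_ne_zero).comp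
      (tendsto_norm_cocompact_atTop (E := EuclideanSpace ℝ (Fin n)))).atTop_div_const
        (show 0 < 4 * t by positivity)
    refine (tendsto_neg_atTop_atBot.comp h).congr fun x => ?_
    simp [neg_div]
  have h2 := (Real.tendsto_exp_atBot.comp h1).const_mul ((4 * Real.pi * t) ^ (-((n : ℝ) / 2)))
  rw [mul_zero] at h2
  exact h2

theorem tendsto_heatSemigroup_cocompact {t : ℝ} (ht : 0 < t) (hf : Integrable f) :
    Tendsto (heatSemigroup t f) (cocompact (EuclideanSpace ℝ (Fin n))) (𝓝 0) := by
  rw [heatSemigroup_eq]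
  have hK : Continuous fun x : EuclideanSpace ℝ (Fin n) => (heatKernel t x : ℂ) :=
    Complex.continuous_ofReal.comp (continuous_heatKernel t)
  have h := tendsto_integral_filter_of_dominated_convergence
    (μ := (volume : Measure (EuclideanSpace ℝ (Fin n))))
    (l := cocompact (EuclideanSpace ℝ (Fin n)))
    (F := fun x z => f z • (heatKernel t (x - z) : ℂ)) (f := fun _ => 0)
    (fun z => ‖f z‖ * (4 * Real.pi * t) ^ (-((n : ℝ) / 2)))
    (Eventually.of_forall fun x =>
      (integrable_smul_comp_sub hf hK (norm_ofReal_heatKernel_le_rpow ht) x).1)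
    (Eventually.of_forall fun x => Eventually.of_forall fun z => ?_)
    (hf.norm.mul_const _) (Eventually.of_forall fun z => ?_)
  · simpa using h
  · rw [norm_smul]
    exact mul_le_mul_of_nonneg_left (norm_ofReal_heatKernel_le_rpow ht _) (norm_nonneg _)
  · have h1 : Tendsto (fun x => heatKernel t (x - z)) (cocompact (EuclideanSpace ℝ (Fin n)))
        (𝓝 0) :=
      (tendsto_heatKernel_cocompact ht).comp
        (Homeomorph.subRight z).isClosedEmbedding.tendsto_cocompact
    simpa using ((Complex.continuous_ofReal.tendsto 0).comp h1).const_smul (f z)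

theorem continuous_heatSemigroup {t : ℝ} (ht : 0 < t) (hf : Integrable f) :
    Continuous (heatSemigroup t f) :=
  continuous_iff_continuousAt.2 fun x => (hasFDerivAt_heatSemigroup ht hf x).continuousAt

/-- An integrable majorant of `t ^ (s - 1) • e^{tΔ} f (x)`, uniform in `x`. -/
noncomputable def heatMajorant (s M : ℝ) (f : EuclideanSpace ℝ (Fin n) → ℂ) (t : ℝ) : ℝ :=
  min (M * t ^ (s - 1))
    (((4 * Real.pi) ^ (-((n : ℝ) / 2)) * ∫ z, ‖f z‖) * t ^ (s - 1 + -((n : ℝ) / 2)))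

theorem norm_rpow_smul_heatSemigroup_le_heatMajorant (hf : Integrable f)
    (hM : ∀ᵐ z, ‖f z‖ ≤ M) {t : ℝ} (ht : 0 < t) (x : EuclideanSpace ℝ (Fin n)) :
    ‖t ^ (s - 1) • heatSemigroup t f x‖ ≤ heatMajorant s M f t :=
  le_min (norm_rpow_smul_heatSemigroup_le hM x t ht)
    (norm_rpow_smul_heatSemigroup_le_integral hf x t ht)

theorem integrableOn_heatMajorant (hs0 : 0 < s) (hsn : s < (n : ℝ) / 2)
    (hM : ∀ᵐ z, ‖f z‖ ≤ M) : IntegrableOn (heatMajorant s M f) (Ioi 0) := by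
  obtain ⟨z, hz⟩ := hM.exists
  have hM0 : 0 ≤ M := (norm_nonneg _).trans hz
  have hI : 0 ≤ ∫ z, ‖f z‖ := integral_nonneg fun _ => norm_nonneg _
  exact integrableOn_min_rpow hM0 (by positivity) (by linarith) (by linarith)

theorem norm_invFracLaplacian_le (hs0 : 0 < s) (hsn : s < (n : ℝ) / 2)
    (hf : Integrable f) (hM : ∀ᵐ z, ‖f z‖ ≤ M) (x : EuclideanSpace ℝ (Fin n)) :
    ‖invFracLaplacian s f x‖ ≤ 1 / Real.Gamma s * ∫ t in Ioi 0, heatMajorant s M f t := by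
  have hΓ := Real.Gamma_pos_of_pos hs0
  rw [invFracLaplacian, norm_one_div_Gamma_smul hs0]
  refine mul_le_mul_of_nonneg_left ?_ (by positivity)
  refine norm_integral_le_of_norm_le (integrableOn_heatMajorant hs0 hsn hM) ?_
  filter_upwards [ae_restrict_mem measurableSet_Ioi] with t ht
  exact norm_rpow_smul_heatSemigroup_le_heatMajorant hf hM ht x

theorem continuous_invFracLaplacian (hs0 : 0 < s) (hsn : s < (n : ℝ) / 2)
    (hf : Integrable f) (hM : ∀ᵐ z, ‖f z‖ ≤ M) : Continuous (invFracLaplacian s f) := by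
  refine Continuous.const_smul (continuous_of_dominated (bound := heatMajorant s M f)
    (fun x => (integrableOn_rpow_smul_heatSemigroup hs0 hsn hf hM x).1) (fun x => ?_)
    (integrableOn_heatMajorant hs0 hsn hM) ?_) (1 / Real.Gamma s)
  · filter_upwards [ae_restrict_mem measurableSet_Ioi] with t ht
    exact norm_rpow_smul_heatSemigroup_le_heatMajorant hf hM ht x
  · filter_upwards [ae_restrict_mem measurableSet_Ioi] with t ht
    exact Continuous.const_smul (continuous_heatSemigroup ht hf) (t ^ (s - 1))

theorem tendsto_invFracLaplacian_cocompact (hs0 : 0 < s) (hsn : s < (n : ℝ) / 2)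
    (hf : Integrable f) (hM : ∀ᵐ z, ‖f z‖ ≤ M) :
    Tendsto (invFracLaplacian s f) (cocompact (EuclideanSpace ℝ (Fin n))) (𝓝 0) := by
  have h := tendsto_integral_filter_of_dominated_convergence
    (μ := (volume : Measure ℝ).restrict (Ioi 0))
    (l := cocompact (EuclideanSpace ℝ (Fin n)))
    (F := fun x t => t ^ (s - 1) • heatSemigroup t f x) (f := fun _ => 0) (heatMajorant s M f)
    (Eventually.of_forall fun x => (integrableOn_rpow_smul_heatSemigroup hs0 hsn hf hM x).1)
    (Eventually.of_forall fun x => ?_) (integrableOn_heatMajorant hs0 hsn hM) ?_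
  · have h' := h.const_smul (1 / Real.Gamma s)
    rwa [integral_zero, smul_zero] at h'
  · filter_upwards [ae_restrict_mem measurableSet_Ioi] with t ht
    exact norm_rpow_smul_heatSemigroup_le_heatMajorant hf hM ht x
  · filter_upwards [ae_restrict_mem measurableSet_Ioi] with t ht
    simpa using (tendsto_heatSemigroup_cocompact ht hf).const_smul (t ^ (s - 1))

end Decay

/-! ### Fourier transforms of products and convolutions. -/

section FourierConvolution

variable {V : Type*} [NormedAddCommGroup V] [InnerProductSpace ℝ V] [FiniteDimensional ℝ V]
  [MeasurableSpace V] [BorelSpace V]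

theorem integral_fourier_mul_eq_of_integrable {f g : V → ℂ} (hf : Integrable f)
    (hg : Integrable g) : ∫ ξ, 𝓕 f ξ * g ξ = ∫ x, f x * 𝓕 g x := by
  have := VectorFourier.integral_fourierIntegral_smul_eq_flip (L := innerₗ V)
    Real.continuous_fourierChar continuous_inner hf hg
  rw [flip_innerₗ] at this
  exact this

theorem integral_fourierInv_mul_eq_of_integrable {f g : V → ℂ} (hf : Integrable f)
    (hg : Integrable g) : ∫ ξ, 𝓕⁻ f ξ * g ξ = ∫ x, f x * 𝓕⁻ g x := by
  have h := integral_fourier_mul_eq_of_integrable hf.comp_neg hg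
  simp_rw [Real.fourierInv_eq_fourier_comp_neg f]
  rw [h, ← integral_neg_eq_self]
  simp_rw [neg_neg, ← Real.fourierInv_eq_fourier_neg]

theorem integrable_fourierChar_smul_iff {f : V → ℂ} (w : V) :
    Integrable (fun v => Real.fourierChar (inner ℝ v w) • f v) ↔ Integrable f := by
  have h := Real.fourierIntegral_convergent_iff (μ := (volume : Measure V)) (f := f) (-w)
  simpa only [inner_neg_right, neg_neg] using h

theorem norm_fourier_le_integral_norm (f : V → ℂ) (ξ : V) : ‖𝓕 f ξ‖ ≤ ∫ x, ‖f x‖ :=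
  VectorFourier.norm_fourierIntegral_le_integral_norm _ _ _ _ _

theorem continuous_fourier_of_integrable {f : V → ℂ} (hf : Integrable f) : Continuous (𝓕 f) :=
  VectorFourier.fourierIntegral_continuous Real.continuous_fourierChar continuous_inner hf

theorem norm_fourierInv_le_integral_norm (f : V → ℂ) (ξ : V) : ‖𝓕⁻ f ξ‖ ≤ ∫ x, ‖f x‖ := by
  rw [Real.fourierInv_eq_fourier_neg]
  exact norm_fourier_le_integral_norm f (-ξ)

theorem continuous_fourierInv_of_integrable {f : V → ℂ} (hf : Integrable f) :
    Continuous (𝓕⁻ f) := by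
  have h := (continuous_fourier_of_integrable hf).comp continuous_neg
  exact h.congr fun x => (Real.fourierInv_eq_fourier_neg f x).symm

theorem fourierInv_add_of_integrable {f g : V → ℂ} (hf : Integrable f) (hg : Integrable g) :
    𝓕⁻ (fun ξ => f ξ + g ξ) = fun x => 𝓕⁻ f x + 𝓕⁻ g x := by
  funext x
  simp only [Real.fourierInv_eq, smul_add]
  exact integral_add ((integrable_fourierChar_smul_iff x).2 hf)
    ((integrable_fourierChar_smul_iff x).2 hg)

/-- The inverse Fourier transform turns the product of a dilation of `𝓕 K` and `g` into a
convolution. -/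
theorem integral_mul_fourierInv_sub_smul
    {K g : V → ℂ} (hK : Integrable K) (hg : Integrable g) (ε : ℝ) (x : V) :
    ∫ y, K y * 𝓕⁻ g (x - ε • y) = 𝓕⁻ (fun ξ => 𝓕 K (ε • ξ) * g ξ) x := by
  have hh : Integrable (fun ξ => Real.fourierChar (inner ℝ ξ x) • g ξ) :=
    (integrable_fourierChar_smul_iff x).2 hg
  have hc : Continuous fun p : V × V => (ε • innerₗ V) p.1 p.2 := by
    simp only [LinearMap.smul_apply, innerₗ_apply_apply]
    fun_prop
  -- The dilation is put into the bilinear form `ε⟨·,·⟩` of the Fourier duality, which avoids a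
  -- change of variables and any condition on `ε`.
  have h := VectorFourier.integral_fourierIntegral_smul_eq_flip (L := ε • innerₗ V)
    Real.continuous_fourierChar hc hK hh
  simp only [VectorFourier.fourierIntegral, LinearMap.flip_apply, LinearMap.smul_apply,
    innerₗ_apply_apply, smul_eq_mul, mul_smul_comm] at h
  rw [Real.fourierInv_eq]
  simp_rw [Real.fourier_eq, inner_smul_right]
  rw [h]
  congr 1 with y
  congr 1
  rw [Real.fourierInv_eq]
  congr 1 with ξ
  rw [smul_smul, ← AddChar.map_add_eq_mul, inner_sub_right, inner_smul_right,
    real_inner_comm y ξ]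
  congr 2
  ring

/-- The inverse Fourier transform turns the product of `𝓕 K` and `g` into the convolution of `K`
and `𝓕⁻ g`. -/
theorem integral_mul_fourierInv_sub {K g : V → ℂ} (hK : Integrable K) (hg : Integrable g)
    (x : V) : ∫ y, K y * 𝓕⁻ g (x - y) = 𝓕⁻ (fun ξ => 𝓕 K ξ * g ξ) x := by
  simpa only [one_smul] using integral_mul_fourierInv_sub_smul hK hg 1 x

theorem integrable_fourier_mul {K g : V → ℂ} (hK : Integrable K) (hg : Integrable g) :
    Integrable (fun ξ => 𝓕 K ξ * g ξ) :=
  hg.bdd_mul (continuous_fourier_of_integrable hK).aestronglyMeasurable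
    (Eventually.of_forall (norm_fourier_le_integral_norm K))

/-- The function is the convolution of `K` and `θ`, both in `L¹`. -/
theorem integrable_fourierInv_fourier_mul {K : V → ℂ} (hK : Integrable K) (θ : 𝓢(V, ℂ)) :
    Integrable (𝓕⁻ (fun ξ => 𝓕 K ξ * 𝓕 (θ : V → ℂ) ξ)) := by
  have hθ : Integrable (𝓕 (θ : V → ℂ)) := by
    rw [← SchwartzMap.fourier_coe]; exact (𝓕 θ).integrable
  have e : 𝓕⁻ (𝓕 (θ : V → ℂ)) = θ := θ.continuous.fourierInv_fourier_eq θ.integrable hθ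
  have h := hK.integrable_convolution (ContinuousLinearMap.mul ℂ ℂ) (θ.integrable (μ := volume))
  refine h.congr (Eventually.of_forall fun x => ?_)
  rw [← integral_mul_fourierInv_sub hK hθ, e]
  rfl

end FourierConvolution

/-! ### Superpositions of heat kernels and the power `r ^ s`. -/

section Subordination

variable {n : ℕ}

/-- Superpositions of heat kernels: their Fourier transforms are the superpositions of
`exp (-t |ξ|²)`. -/
theorem exists_integrable_fourier_eq_integral_exp {h : ℝ → ℝ} (hh : IntegrableOn h (Ioi 0)) :
    ∃ K : EuclideanSpace ℝ (Fin n) → ℂ, Integrable K ∧ ∀ ξ, 𝓕 K ξ =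
      ((∫ t in Ioi (0 : ℝ), h t * Real.exp (-(t * (2 * Real.pi * ‖ξ‖) ^ 2)) : ℝ) : ℂ) := by
  have hmeas : AEStronglyMeasurable (fun p : ℝ × EuclideanSpace ℝ (Fin n) =>
      ((h p.1 : ℂ) * (heatKernel p.1 p.2 : ℂ))) ((volume.restrict (Ioi 0)).prod volume) :=
    (Complex.continuous_ofReal.comp_aestronglyMeasurable hh.1.comp_fst).mul
      (Complex.measurable_ofReal.comp measurable_heatKernel_uncurry).aestronglyMeasurable
  -- Each heat kernel has mass one, so the joint `L¹` norm is `∫ |h|`.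
  have hint : Integrable (fun p : ℝ × EuclideanSpace ℝ (Fin n) =>
      ((h p.1 : ℂ) * (heatKernel p.1 p.2 : ℂ))) ((volume.restrict (Ioi 0)).prod volume) := by
    refine (integrable_prod_iff hmeas).2 ⟨?_, ?_⟩
    · filter_upwards [ae_restrict_mem measurableSet_Ioi] with t ht
      exact (integrable_heatKernel ht).ofReal.const_mul _
    · refine hh.norm.congr ?_
      filter_upwards [ae_restrict_mem measurableSet_Ioi] with t ht
      have : ∀ y : EuclideanSpace ℝ (Fin n), ‖(h t : ℂ) * (heatKernel t y : ℂ)‖ =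
          ‖h t‖ * heatKernel t y := fun y => by
        rw [norm_mul, Complex.norm_real, Complex.norm_real,
          Real.norm_of_nonneg (heatKernel_nonneg ht y)]
      simp_rw [this]
      rw [integral_const_mul, integral_heatKernel ht, mul_one]
  refine ⟨fun y => ∫ t in Ioi 0, (h t : ℂ) * (heatKernel t y : ℂ), hint.integral_prod_right,
    fun ξ => ?_⟩
  rw [Real.fourier_eq]
  have hint2 : Integrable (Function.uncurry fun (y : EuclideanSpace ℝ (Fin n)) (t : ℝ) =>
      Real.fourierChar (-inner ℝ y ξ) • ((h t : ℂ) * (heatKernel t y : ℂ)))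
      (volume.prod (volume.restrict (Ioi 0))) := by
    have hc : Continuous fun p : EuclideanSpace ℝ (Fin n) × ℝ =>
        Real.fourierChar (-inner ℝ p.1 ξ) :=
      Real.continuous_fourierChar.comp (by fun_prop)
    exact hint.swap.mono (hc.aestronglyMeasurable.smul hint.swap.1)
      (Eventually.of_forall fun p => (Circle.norm_smul _ _).le)
  have hswap := integral_integral_swap hint2
  have e1 : ∀ y : EuclideanSpace ℝ (Fin n), Real.fourierChar (-inner ℝ y ξ) •
      ∫ t in Ioi 0, (h t : ℂ) * (heatKernel t y : ℂ) = ∫ t in Ioi 0,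
        Real.fourierChar (-inner ℝ y ξ) • ((h t : ℂ) * (heatKernel t y : ℂ)) := fun y => by
    simp_rw [Circle.smul_def]
    rw [integral_smul]
  simp_rw [e1]
  rw [hswap, ← integral_complex_ofReal]
  refine setIntegral_congr_fun measurableSet_Ioi fun t ht => ?_
  simp only [← mul_smul_comm]
  rw [integral_const_mul, ← Real.fourier_eq (fun y => (heatKernel t y : ℂ)),
    fourier_heatKernel ht]
  push_cast
  rfl

theorem integrableOn_rpow_mul_exp_neg_mul {a r : ℝ} (ha : 0 < a) (hr : 0 < r) :
    IntegrableOn (fun t : ℝ => t ^ (a - 1) * Real.exp (-(r * t))) (Ioi 0) := by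
  refine Integrable.of_integral_ne_zero ?_
  rw [Real.integral_rpow_mul_exp_neg_mul_Ioi ha hr]
  have := Real.Gamma_pos_of_pos ha
  positivity

/-- Integration by parts trades `t^{-s}`, not integrable at infinity for `s < 1`, for the integrable
`t^{-s-1}` and a boundary term at `t = 1`. -/
theorem integral_Ioi_one_rpow_mul_exp {s r : ℝ} (hs0 : 0 < s) (hr : 0 ≤ r) :
    r * (∫ t in Ioi (1 : ℝ), t ^ (-s) * Real.exp (-(r * t))) =
      Real.exp (-r) - s * ∫ t in Ioi (1 : ℝ), t ^ (-s - 1) * Real.exp (-(r * t)) := by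
  have hb : IntegrableOn (fun t : ℝ => t ^ (-s - 1) * Real.exp (-(r * t))) (Ioi 1) := by
    have hm : Measurable fun t : ℝ => t ^ (-s - 1) * Real.exp (-(r * t)) := by fun_prop
    refine Integrable.mono (integrableOn_Ioi_rpow_of_lt (a := -s - 1) (by linarith) one_pos)
      hm.aestronglyMeasurable ?_
    filter_upwards [ae_restrict_mem measurableSet_Ioi] with t ht
    have ht0 : (0 : ℝ) < t := one_pos.trans ht
    rw [norm_mul, Real.norm_of_nonneg (Real.exp_nonneg _)]
    exact mul_le_of_le_one_right (norm_nonneg _)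
      (Real.exp_le_one_iff.2 (neg_nonpos.2 (by positivity)))
  -- For `r = 0` the prefactor makes the integrand vanish; for `r > 0` the exponential gives the
  -- integrability.
  have ha : IntegrableOn (fun t : ℝ => r * (t ^ (-s) * Real.exp (-(r * t)))) (Ioi 1) := by
    rcases hr.eq_or_lt with rfl | hr
    · simp
    have h0 : IntegrableOn (fun t : ℝ => Real.exp (-r * t)) (Ioi 1) :=
      integrableOn_exp_mul_Ioi (by linarith) 1
    have hm : Measurable fun t : ℝ => t ^ (-s) * Real.exp (-(r * t)) := by fun_prop
    refine Integrable.const_mul (Integrable.mono h0 hm.aestronglyMeasurable ?_) r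
    filter_upwards [ae_restrict_mem measurableSet_Ioi] with t ht
    have ht1 : (1 : ℝ) < t := ht
    rw [norm_mul, neg_mul]
    refine mul_le_of_le_one_left (norm_nonneg _) ?_
    rw [Real.norm_of_nonneg (by positivity)]
    exact Real.rpow_le_one_of_one_le_of_nonpos ht1.le (by linarith)
  have hd : ∀ t ∈ Ioi (1 : ℝ), HasDerivAt (fun t : ℝ => -(t ^ (-s) * Real.exp (-(r * t))))
      (s * (t ^ (-s - 1) * Real.exp (-(r * t))) + r * (t ^ (-s) * Real.exp (-(r * t)))) t := by
    intro t ht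
    have ht0 : t ≠ 0 := (one_pos.trans ht).ne'
    have h1 := Real.hasDerivAt_rpow_const (p := -s) (Or.inl ht0)
    have h2 : HasDerivAt (fun t : ℝ => Real.exp (-(r * t))) (Real.exp (-(r * t)) * -(r * 1)) t :=
      (((hasDerivAt_id t).const_mul r).neg).exp
    refine (h1.mul h2).neg.congr_deriv ?_
    ring
  have hcont : ContinuousWithinAt (fun t : ℝ => -(t ^ (-s) * Real.exp (-(r * t)))) (Ici 1) 1 := by
    refine ContinuousAt.continuousWithinAt ?_
    have : ContinuousAt (fun t : ℝ => t ^ (-s)) 1 := Real.continuousAt_rpow_const _ _ (by simp)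
    fun_prop
  have hlim : Tendsto (fun t : ℝ => -(t ^ (-s) * Real.exp (-(r * t)))) atTop (𝓝 0) := by
    refine squeeze_zero_norm' ?_ (tendsto_rpow_neg_atTop hs0)
    filter_upwards [eventually_gt_atTop 0] with t ht
    rw [norm_neg, norm_mul, Real.norm_of_nonneg (Real.exp_nonneg _),
      Real.norm_of_nonneg (by positivity)]
    exact mul_le_of_le_one_right (by positivity)
      (Real.exp_le_one_iff.2 (neg_nonpos.2 (by positivity)))
  have key := integral_Ioi_of_hasDerivAt_of_tendsto hcont hd ((hb.const_mul s).add ha) hlim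
  rw [integral_add (hb.const_mul s) ha, integral_const_mul, integral_const_mul] at key
  simp only [Real.one_rpow, mul_one, one_mul, sub_neg_eq_add, zero_add] at key
  linarith

/-- The power `r ^ s` as a combination of Laplace transforms of integrable functions. -/
theorem Gamma_mul_rpow_eq {s r : ℝ} (hs0 : 0 < s) (hs1 : s < 1) (hr : 0 ≤ r) :
    Real.Gamma (1 - s) * r ^ s = r * (∫ t in Ioc (0 : ℝ) 1, t ^ (-s) * Real.exp (-(r * t))) +
      Real.exp (-r) - s * ∫ t in Ioi (1 : ℝ), t ^ (-s - 1) * Real.exp (-(r * t)) := by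
  have h1 := integral_Ioi_one_rpow_mul_exp hs0 hr
  rw [add_sub_assoc, ← h1, ← mul_add]
  rcases hr.eq_or_lt with rfl | hr
  · simp [Real.zero_rpow hs0.ne']
  -- With the tail put back, both integrals recombine to `∫ t^{-s} e^{-rt} dt = Γ(1-s) r^{s-1}`, and
  -- `r` times this is the claim.
  have hint := integrableOn_rpow_mul_exp_neg_mul (a := 1 - s) (by linarith) hr
  have hval := Real.integral_rpow_mul_exp_neg_mul_Ioi (a := 1 - s) (by linarith) hr
  rw [show 1 - s - 1 = -s by ring] at hint hval
  rw [← Ioc_union_Ioi_eq_Ioi (zero_le_one (α := ℝ))] at hint hval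
  rw [setIntegral_union (Ioc_disjoint_Ioi le_rfl) measurableSet_Ioi hint.left_of_union
    hint.right_of_union] at hval
  rw [hval, one_div, Real.inv_rpow hr.le, ← Real.rpow_neg hr.le]
  have e : r ^ s = r * r ^ (-(1 - s)) := by
    rw [← Real.rpow_one_add' hr.le (by linarith)]; congr 1; ring
  rw [e]; ring

end Subordination

/-! ### Integrability of `(-Δ)^s φ` and the equation for the potential. -/

section FractionalLaplacian

variable {n : ℕ}

/-- `Φ` is `-Δφ`, produced on the Fourier side. -/
theorem exists_schwartzMap_fourier_eq_sq_mul (φ : 𝓢(EuclideanSpace ℝ (Fin n), ℂ)) :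
    ∃ Φ : 𝓢(EuclideanSpace ℝ (Fin n), ℂ), ∀ ξ, 𝓕 (Φ : EuclideanSpace ℝ (Fin n) → ℂ) ξ =
      (((2 * Real.pi * ‖ξ‖) ^ 2 : ℝ) : ℂ) * 𝓕 (φ : EuclideanSpace ℝ (Fin n) → ℂ) ξ := by
  have hg : Function.HasTemperateGrowth
      (fun ξ : EuclideanSpace ℝ (Fin n) => (2 * Real.pi * ‖ξ‖) ^ 2) := by
    simp_rw [mul_pow _ ‖_‖]
    exact (Function.HasTemperateGrowth.const _).mul (Function.hasTemperateGrowth_norm_sq _)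
  refine ⟨𝓕⁻ (SchwartzMap.smulLeftCLM ℂ
    (fun ξ : EuclideanSpace ℝ (Fin n) => (2 * Real.pi * ‖ξ‖) ^ 2) (𝓕 φ)), fun ξ => ?_⟩
  rw [← SchwartzMap.fourier_coe, FourierTransform.fourier_fourierInv_eq,
    SchwartzMap.smulLeftCLM_apply_apply hg, Complex.real_smul, SchwartzMap.fourier_coe]

theorem integrable_fourier_schwartzMap (φ : 𝓢(EuclideanSpace ℝ (Fin n), ℂ)) :
    Integrable (𝓕 (φ : EuclideanSpace ℝ (Fin n) → ℂ)) := by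
  rw [← SchwartzMap.fourier_coe]; exact (𝓕 φ).integrable

theorem fourierInv_fourier_schwartzMap (φ : 𝓢(EuclideanSpace ℝ (Fin n), ℂ)) :
    𝓕⁻ (𝓕 (φ : EuclideanSpace ℝ (Fin n) → ℂ)) = φ :=
  φ.continuous.fourierInv_fourier_eq φ.integrable (integrable_fourier_schwartzMap φ)

theorem setIntegral_indicator_mul {S T : Set ℝ} (hT : MeasurableSet T) (hTS : T ⊆ S)
    (h g : ℝ → ℝ) : ∫ t in S, T.indicator h t * g t = ∫ t in T, h t * g t := by
  have e : (fun t => T.indicator h t * g t) = T.indicator fun t => h t * g t := by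
    funext t
    exact (indicator_mul_left T h g).symm
  rw [e, setIntegral_indicator hT, inter_eq_self_of_subset_right hTS]

/-- The multiplier of the fractional Laplacian is a combination of Fourier transforms of
integrable functions. -/
theorem exists_integrable_fourier_symbol {s : ℝ} (hs0 : 0 < s) (hs1 : s < 1) :
    ∃ K₁ K₂ : EuclideanSpace ℝ (Fin n) → ℂ, Integrable K₁ ∧ Integrable K₂ ∧ ∀ ξ,
      (((2 * Real.pi * ‖ξ‖) ^ (2 * s) : ℝ) : ℂ) =
        𝓕 K₁ ξ * (((2 * Real.pi * ‖ξ‖) ^ 2 : ℝ) : ℂ) + 𝓕 K₂ ξ := by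
  have hΓ := Real.Gamma_pos_of_pos (show 0 < 1 - s by linarith)
  set c : ℝ := 1 / Real.Gamma (1 - s) with hc
  -- The two densities are read off from `Gamma_mul_rpow_eq` with `r = |ξ|²`. Its boundary term
  -- `e^{-r}` is the transform of the heat kernel at time 1, which is added to `K₂`.
  have h1 : IntegrableOn ((Ioc (0 : ℝ) 1).indicator fun t => c * t ^ (-s)) (Ioi 0) :=
    ((integrable_indicator_iff measurableSet_Ioc).2
      ((integrableOn_Ioc_zero_rpow (by linarith) one_pos).const_mul c)).integrableOn
  have h2 : IntegrableOn ((Ioi (1 : ℝ)).indicator fun t => -(c * s) * t ^ (-s - 1)) (Ioi 0) :=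
    ((integrable_indicator_iff measurableSet_Ioi).2
      ((integrableOn_Ioi_rpow_of_lt (by linarith) one_pos).const_mul _)).integrableOn
  obtain ⟨K₁, hK₁, e1⟩ := exists_integrable_fourier_eq_integral_exp (n := n) h1
  obtain ⟨K₂, hK₂, e2⟩ := exists_integrable_fourier_eq_integral_exp (n := n) h2
  have hG : Integrable fun x : EuclideanSpace ℝ (Fin n) => (c : ℂ) * (heatKernel 1 x : ℂ) :=
    (integrable_heatKernel one_pos).ofReal.const_mul _
  refine ⟨K₁, fun x => K₂ x + (c : ℂ) * (heatKernel 1 x : ℂ), hK₁, hK₂.add hG, fun ξ => ?_⟩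
  have eG : 𝓕 (fun x : EuclideanSpace ℝ (Fin n) => K₂ x + (c : ℂ) * (heatKernel 1 x : ℂ)) ξ =
      𝓕 K₂ ξ + c * (Real.exp (-(1 * (2 * Real.pi * ‖ξ‖) ^ 2)) : ℝ) := by
    rw [← fourier_heatKernel one_pos ξ]
    simp only [Real.fourier_eq, smul_add, ← mul_smul_comm]
    rw [integral_add, integral_const_mul]
    · simpa using (integrable_fourierChar_smul_iff (-ξ)).2 hK₂
    · have := (integrable_fourierChar_smul_iff (-ξ)).2 hG
      simpa [← mul_smul_comm] using this
  rw [eG, e1, e2]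
  set r : ℝ := (2 * Real.pi * ‖ξ‖) ^ 2 with hr
  have hr0 : 0 ≤ r := by positivity
  have hrs : (2 * Real.pi * ‖ξ‖) ^ (2 * s) = r ^ s := by
    rw [hr, sq_rpow_eq (by positivity)]
  have i1 : ∫ t in Ioi (0 : ℝ), (Ioc (0 : ℝ) 1).indicator (fun t => c * t ^ (-s)) t *
      Real.exp (-(t * r)) = c * ∫ t in Ioc (0 : ℝ) 1, t ^ (-s) * Real.exp (-(r * t)) := by
    rw [setIntegral_indicator_mul measurableSet_Ioc Ioc_subset_Ioi_self, ← integral_const_mul]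
    simp_rw [mul_assoc, mul_comm r]
  have i2 : ∫ t in Ioi (0 : ℝ), (Ioi (1 : ℝ)).indicator (fun t => -(c * s) * t ^ (-s - 1)) t *
      Real.exp (-(t * r)) =
        -(c * s) * ∫ t in Ioi (1 : ℝ), t ^ (-s - 1) * Real.exp (-(r * t)) := by
    rw [setIntegral_indicator_mul measurableSet_Ioi (Ioi_subset_Ioi zero_le_one),
      ← integral_const_mul]
    simp_rw [mul_assoc, mul_comm r]
  have key := Gamma_mul_rpow_eq hs0 hs1 hr0
  rw [i1, i2, hrs, one_mul]
  have : r ^ s = c * (Real.Gamma (1 - s) * r ^ s) := by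
    rw [hc]; field_simp
  rw [this, key]
  push_cast
  ring

theorem fracLaplacianSchwartz_eq (s : ℝ) (φ : 𝓢(EuclideanSpace ℝ (Fin n), ℂ)) :
    fracLaplacianSchwartz s φ = 𝓕⁻ (fun ξ : EuclideanSpace ℝ (Fin n) =>
      (((2 * Real.pi * ‖ξ‖) ^ (2 * s) : ℝ) : ℂ) * 𝓕 (φ : EuclideanSpace ℝ (Fin n) → ℂ) ξ) := rfl

/-- By the decomposition of the symbol, `(-Δ)^s φ = K₁ * (-Δφ) + K₂ * φ`, a sum of convolutions of
`L¹` functions. Pairings with bounded functions are thereby absolutely convergent. -/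
theorem integrable_symbol_mul_fourier {s : ℝ} (hs0 : 0 < s) (hs1 : s < 1)
    (φ : 𝓢(EuclideanSpace ℝ (Fin n), ℂ)) :
    Integrable (fun ξ : EuclideanSpace ℝ (Fin n) =>
      (((2 * Real.pi * ‖ξ‖) ^ (2 * s) : ℝ) : ℂ) * 𝓕 (φ : EuclideanSpace ℝ (Fin n) → ℂ) ξ) ∧
    Integrable (fracLaplacianSchwartz s φ) := by
  obtain ⟨K₁, K₂, hK₁, hK₂, hK⟩ := exists_integrable_fourier_symbol (n := n) hs0 hs1
  obtain ⟨Φ, hΦ⟩ := exists_schwartzMap_fourier_eq_sq_mul φ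
  have e : (fun ξ : EuclideanSpace ℝ (Fin n) => (((2 * Real.pi * ‖ξ‖) ^ (2 * s) : ℝ) : ℂ) *
      𝓕 (φ : EuclideanSpace ℝ (Fin n) → ℂ) ξ) = fun ξ =>
        𝓕 K₁ ξ * 𝓕 (Φ : EuclideanSpace ℝ (Fin n) → ℂ) ξ +
          𝓕 K₂ ξ * 𝓕 (φ : EuclideanSpace ℝ (Fin n) → ℂ) ξ := by
    funext ξ
    rw [hK, hΦ]; ring
  have i1 := integrable_fourier_mul hK₁ (integrable_fourier_schwartzMap Φ)
  have i2 := integrable_fourier_mul hK₂ (integrable_fourier_schwartzMap φ)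
  rw [fracLaplacianSchwartz_eq, e, fourierInv_add_of_integrable i1 i2]
  exact ⟨i1.add i2, (integrable_fourierInv_fourier_mul hK₁ Φ).add
    (integrable_fourierInv_fourier_mul hK₂ φ)⟩

/-- The even heat kernel moves from `f` to `𝓕⁻ g`, where it acts as a Gaussian multiplier; the
inverse transform then moves to `f`. -/
theorem integral_heatSemigroup_mul_fourierInv {f g : EuclideanSpace ℝ (Fin n) → ℂ} {t : ℝ}
    (ht : 0 < t) (hf : Integrable f) (hg : Integrable g) (hg' : Integrable (𝓕⁻ g)) :
    ∫ x, heatSemigroup t f x * 𝓕⁻ g x =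
      ∫ ξ, 𝓕⁻ f ξ * ((Real.exp (-(t * (2 * Real.pi * ‖ξ‖) ^ 2)) : ℝ) * g ξ) := by
  have hK := integrable_fourier_mul (integrable_heatKernel ht).ofReal hg
  simp_rw [Complex.coe_algebraMap] at hK
  simp_rw [fourier_heatKernel ht] at hK
  rw [integral_fourierInv_mul_eq_of_integrable hf hK]
  have hcont : Continuous fun p : EuclideanSpace ℝ (Fin n) × EuclideanSpace ℝ (Fin n) =>
      (heatKernel t (p.1 - p.2) : ℂ) :=
    Complex.continuous_ofReal.comp ((continuous_heatKernel t).comp (by fun_prop))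
  have hint : Integrable (Function.uncurry fun x z : EuclideanSpace ℝ (Fin n) =>
      f z * (heatKernel t (x - z) : ℂ) * 𝓕⁻ g x) (volume.prod volume) := by
    have h0 := (hg'.mul_prod hf).mul_bdd (c := (4 * Real.pi * t) ^ (-((n : ℝ) / 2)))
      hcont.aestronglyMeasurable
      (Eventually.of_forall fun p => norm_ofReal_heatKernel_le_rpow ht (p.1 - p.2))
    refine h0.congr (Eventually.of_forall fun p => ?_)
    simp only [Function.uncurry]
    ring
  have e1 : ∀ x, heatSemigroup t f x * 𝓕⁻ g x =
      ∫ z, f z * (heatKernel t (x - z) : ℂ) * 𝓕⁻ g x := fun x => by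
    rw [heatSemigroup_eq, ← integral_mul_const]
    rfl
  simp_rw [e1]
  rw [integral_integral_swap hint]
  congr 1 with z
  have e2 : ∀ x, f z * (heatKernel t (x - z) : ℂ) * 𝓕⁻ g x =
      f z * ((heatKernel t (x - z) : ℂ) * 𝓕⁻ g x) := fun x => mul_assoc _ _ _
  simp_rw [e2]
  rw [integral_const_mul]
  congr 1
  have h2 := integral_mul_fourierInv_sub (integrable_heatKernel ht).ofReal hg z
  simp_rw [Complex.coe_algebraMap] at h2
  simp_rw [fourier_heatKernel ht] at h2
  rw [← h2, ← integral_sub_left_eq_self _ volume z]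
  congr 1 with x
  rw [← heatKernel_neg, show -(z - x - z) = x by abel]

/-- For every `ξ ≠ 0` the positive kernel in `t` has integral exactly `Γ(s)`, since the symbol
cancels the Gamma integral. Hence the double integral is absolutely convergent for any integrable
`q`. The origin is a null set because `n > 0`. -/
theorem integral_rpow_mul_integral_exp_mul {s : ℝ} (hs0 : 0 < s) (hn : 0 < n)
    {q : EuclideanSpace ℝ (Fin n) → ℂ} (hq : Integrable q) :
    ∫ t in Ioi (0 : ℝ), ((t ^ (s - 1) : ℝ) : ℂ) * ∫ ξ,
      (Real.exp (-(t * (2 * Real.pi * ‖ξ‖) ^ 2)) : ℝ) *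
        ((((2 * Real.pi * ‖ξ‖) ^ (2 * s) : ℝ) : ℂ) * q ξ) = Real.Gamma s * ∫ ξ, q ξ := by
  have : Nonempty (Fin n) := ⟨⟨0, hn⟩⟩
  have hΓ := Real.Gamma_pos_of_pos hs0
  let k : ℝ → EuclideanSpace ℝ (Fin n) → ℝ := fun t ξ =>
    (2 * Real.pi * ‖ξ‖) ^ (2 * s) * (t ^ (s - 1) * Real.exp (-((2 * Real.pi * ‖ξ‖) ^ 2 * t)))
  have hkm : Measurable (Function.uncurry k) := by
    simp only [k, Function.uncurry_def]
    fun_prop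
  have hk0 : ∀ t > 0, ∀ ξ, 0 ≤ k t ξ := fun t ht ξ => by simp only [k]; positivity
  have hki : ∀ ξ, ξ ≠ 0 → IntegrableOn (fun t => k t ξ) (Ioi 0) := fun ξ hξ =>
    (integrableOn_rpow_mul_exp_neg_mul hs0 (by positivity)).const_mul _
  have hkv : ∀ ξ, ξ ≠ 0 → ∫ t in Ioi 0, k t ξ = Real.Gamma s := fun ξ hξ => by
    simp only [k]
    have hρ : 0 < 2 * Real.pi * ‖ξ‖ := by positivity
    rw [integral_const_mul, Real.integral_rpow_mul_exp_neg_mul_Ioi hs0 (by positivity),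
      one_div, Real.inv_rpow (by positivity), sq_rpow_eq hρ.le]
    have : (2 * Real.pi * ‖ξ‖) ^ (2 * s) ≠ 0 := (Real.rpow_pos_of_pos hρ _).ne'
    field_simp
  have hne : ∀ᵐ ξ : EuclideanSpace ℝ (Fin n), ξ ≠ 0 := Measure.ae_ne volume 0
  have hint : Integrable (Function.uncurry fun t ξ => (k t ξ : ℂ) * q ξ)
      ((volume.restrict (Ioi 0)).prod volume) := by
    have hm : AEStronglyMeasurable (Function.uncurry fun t ξ => (k t ξ : ℂ) * q ξ)
        ((volume.restrict (Ioi 0)).prod volume) :=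
      (Complex.measurable_ofReal.comp hkm).aestronglyMeasurable.mul hq.1.comp_snd
    refine (integrable_prod_iff' hm).2 ⟨?_, ?_⟩
    · filter_upwards [hne] with ξ hξ
      exact Integrable.mul_const (𝕜 := ℂ) (Integrable.ofReal (hki ξ hξ)) (q ξ)
    · refine (hq.norm.const_mul (Real.Gamma s)).congr ?_
      filter_upwards [hne] with ξ hξ
      have : ∫ t in Ioi 0, ‖(k t ξ : ℂ) * q ξ‖ = ∫ t in Ioi 0, k t ξ * ‖q ξ‖ := by
        refine setIntegral_congr_fun measurableSet_Ioi fun t ht => ?_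
        simp only [norm_mul, Complex.norm_real, Real.norm_of_nonneg (hk0 t ht ξ)]
      simp only [Function.uncurry]
      rw [this, integral_mul_const, hkv ξ hξ]
  have hswap := integral_integral_swap hint
  have e1 : ∀ t, ((t ^ (s - 1) : ℝ) : ℂ) * ∫ ξ, (Real.exp (-(t * (2 * Real.pi * ‖ξ‖) ^ 2)) : ℝ) *
      ((((2 * Real.pi * ‖ξ‖) ^ (2 * s) : ℝ) : ℂ) * q ξ) = ∫ ξ, (k t ξ : ℂ) * q ξ := fun t => by
    rw [← integral_const_mul]
    congr 1 with ξ
    simp only [k, mul_comm t]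
    push_cast
    ring
  simp_rw [e1]
  rw [hswap, ← integral_const_mul]
  refine integral_congr_ae ?_
  filter_upwards [hne] with ξ hξ
  rw [integral_mul_const, integral_complex_ofReal, hkv ξ hξ]

/-- Fubini in `(t, x)` is justified by the product of the majorant in `t` and the integrable `(-Δ)^s
φ`. After passage to frequencies the factor `Γ(s)` cancels and Fourier inversion for `φ` remains. -/
theorem integral_invFracLaplacian_mul_fracLaplacianSchwartz {s M : ℝ} (hs0 : 0 < s) (hs1 : s < 1)
    (hsn : s < (n : ℝ) / 2) {f : EuclideanSpace ℝ (Fin n) → ℂ} (hf : Integrable f)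
    (hM : ∀ᵐ z, ‖f z‖ ≤ M) (φ : 𝓢(EuclideanSpace ℝ (Fin n), ℂ)) :
    ∫ x, invFracLaplacian s f x * fracLaplacianSchwartz s φ x = ∫ x, f x * φ x := by
  have hn : 0 < n := by
    rcases Nat.eq_zero_or_pos n with rfl | h
    · norm_num at hsn; linarith
    · exact h
  have hΓ := Real.Gamma_pos_of_pos hs0
  obtain ⟨hg, hψ⟩ := integrable_symbol_mul_fourier hs0 hs1 φ
  set ψ := fracLaplacianSchwartz s φ with hψdef
  have hint : Integrable (Function.uncurry fun (t : ℝ) (x : EuclideanSpace ℝ (Fin n)) =>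
      t ^ (s - 1) • heatSemigroup t f x * ψ x) ((volume.restrict (Ioi 0)).prod volume) := by
    refine ((integrableOn_heatMajorant hs0 hsn hM).mul_prod hψ.norm).mono'
      ((stronglyMeasurable_rpow_smul_heatSemigroup hf.1 (s - 1)).aestronglyMeasurable.mul
        hψ.1.comp_snd) ?_
    have hae : ∀ᵐ p : ℝ × EuclideanSpace ℝ (Fin n) ∂((volume.restrict (Ioi 0)).prod volume),
        p.1 ∈ Ioi (0 : ℝ) :=
      Measure.quasiMeasurePreserving_fst.ae (ae_restrict_mem measurableSet_Ioi)
    filter_upwards [hae] with p hp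
    simp only [Function.uncurry]
    rw [norm_mul]
    exact mul_le_mul_of_nonneg_right
      (norm_rpow_smul_heatSemigroup_le_heatMajorant hf hM hp p.2) (norm_nonneg _)
  have e1 : ∀ x, invFracLaplacian s f x * ψ x = ((1 / Real.Gamma s : ℝ) : ℂ) *
      ∫ t in Ioi (0 : ℝ), t ^ (s - 1) • heatSemigroup t f x * ψ x := fun x => by
    rw [integral_mul_const, ← mul_assoc, invFracLaplacian, Complex.real_smul]
  simp_rw [e1]
  rw [integral_const_mul, ← integral_integral_swap hint]
  have e2 : ∫ t in Ioi (0 : ℝ), ∫ x, t ^ (s - 1) • heatSemigroup t f x * ψ x =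
      ∫ t in Ioi (0 : ℝ), ((t ^ (s - 1) : ℝ) : ℂ) * ∫ ξ,
        (Real.exp (-(t * (2 * Real.pi * ‖ξ‖) ^ 2)) : ℝ) *
          ((((2 * Real.pi * ‖ξ‖) ^ (2 * s) : ℝ) : ℂ) *
            (𝓕⁻ f ξ * 𝓕 (φ : EuclideanSpace ℝ (Fin n) → ℂ) ξ)) := by
    refine setIntegral_congr_fun measurableSet_Ioi fun t ht => ?_
    simp only [Complex.real_smul, mul_assoc ((t ^ (s - 1) : ℝ) : ℂ)]
    rw [integral_const_mul, hψdef, fracLaplacianSchwartz_eq,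
      integral_heatSemigroup_mul_fourierInv ht hf hg (by rwa [← fracLaplacianSchwartz_eq])]
    congr 2 with ξ
    ring
  have hq : Integrable fun ξ => 𝓕⁻ f ξ * 𝓕 (φ : EuclideanSpace ℝ (Fin n) → ℂ) ξ :=
    (integrable_fourier_schwartzMap φ).bdd_mul
      (continuous_fourierInv_of_integrable hf).aestronglyMeasurable
      (Eventually.of_forall (norm_fourierInv_le_integral_norm f))
  rw [e2, integral_rpow_mul_integral_exp_mul hs0 hn hq, ← mul_assoc, ← Complex.ofReal_mul,
    one_div_mul_cancel hΓ.ne', Complex.ofReal_one, one_mul,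
    integral_fourierInv_mul_eq_of_integrable hf (integrable_fourier_schwartzMap φ),
    fourierInv_fourier_schwartzMap]

theorem ae_norm_le_toReal_eLpNorm_top {w : EuclideanSpace ℝ (Fin n) → ℂ} (hw : MemLp w ∞) :
    ∀ᵐ x, ‖w x‖ ≤ (eLpNorm w ∞ volume).toReal := by
  have h := hw.eLpNorm_ne_top
  rw [eLpNorm_exponent_top] at h ⊢
  filter_upwards [enorm_ae_le_eLpNormEssSup w volume] with x hx
  rw [← toReal_enorm]
  exact ENNReal.toReal_mono h hx

theorem memLs_of_memLp_top {s : ℝ} (hs0 : 0 < s) {w : EuclideanSpace ℝ (Fin n) → ℂ}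
    (hw : MemLp w ∞) : MemLs s w := by
  have hr : 0 < (n : ℝ) + 2 * s := by positivity
  have hbase : Integrable (fun x : EuclideanSpace ℝ (Fin n) =>
      (1 + ‖x‖) ^ (-((n : ℝ) + 2 * s))) :=
    integrable_one_add_norm (by rw [finrank_euclideanSpace_fin]; linarith)
  have hint : Integrable (fun x : EuclideanSpace ℝ (Fin n) =>
      (1 + ‖x‖ ^ ((n : ℝ) + 2 * s))⁻¹) := by
    refine (hbase.const_mul (2 ^ ((n : ℝ) + 2 * s))).mono'
      (Measurable.aestronglyMeasurable (by fun_prop)) (Eventually.of_forall fun x => ?_)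
    rw [Real.norm_of_nonneg (by positivity), Real.rpow_neg (by positivity),
      ← div_eq_mul_inv, ← Real.div_rpow zero_le_two (by positivity),
      inv_le_iff_one_le_mul₀ (by positivity)]
    -- This is `1 + ‖x‖ ≤ 2 max(1, ‖x‖)`, raised to the power.
    have h1 : (1 : ℝ) ≤ (2 / (1 + ‖x‖)) ^ ((n : ℝ) + 2 * s) *
        (max 1 ‖x‖) ^ ((n : ℝ) + 2 * s) := by
      rw [← Real.mul_rpow (by positivity) (by positivity)]
      refine Real.one_le_rpow ?_ hr.le
      rw [div_mul_eq_mul_div, le_div_iff₀ (by positivity)]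
      linarith [le_max_left 1 ‖x‖, le_max_right 1 ‖x‖]
    refine h1.trans (mul_le_mul_of_nonneg_left ?_ (by positivity))
    rcases le_total 1 ‖x‖ with h | h
    · rw [max_eq_right h]; linarith
    · rw [max_eq_left h, Real.one_rpow]
      linarith [Real.rpow_nonneg (norm_nonneg x) ((n : ℝ) + 2 * s)]
  have hb : ∀ᵐ x, ‖w x‖ ≤ (eLpNorm w ∞ volume).toReal := ae_norm_le_toReal_eLpNorm_top hw
  exact hint.smul_bdd _ hw.1 hb

end FractionalLaplacian

/-! ### The Liouville theorem for `(-Δ)^s`. -/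

section Liouville

variable {n : ℕ}

/-- The correlation `∫ v(x) θ(x - y) dx` of a bounded function with a test function. -/
noncomputable def correlation (v θ : EuclideanSpace ℝ (Fin n) → ℂ)
    (y : EuclideanSpace ℝ (Fin n)) : ℂ := ∫ x, v x * θ (x - y)

variable {v θ : EuclideanSpace ℝ (Fin n) → ℂ} {M : ℝ}

theorem norm_correlation_le (hM : ∀ᵐ x, ‖v x‖ ≤ M) (hθ : Integrable θ)
    (y : EuclideanSpace ℝ (Fin n)) : ‖correlation v θ y‖ ≤ M * ∫ x, ‖θ x‖ := by
  rw [← integral_sub_right_eq_self (fun x => ‖θ x‖) y, ← integral_const_mul]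
  refine norm_integral_le_of_norm_le ((hθ.comp_sub_right y).norm.const_mul M) ?_
  filter_upwards [hM] with x hx
  rw [norm_mul]
  exact mul_le_mul_of_nonneg_right hx (norm_nonneg _)

theorem continuous_correlation (hv : MemLp v ∞) (hθ : Continuous θ) (hc : HasCompactSupport θ) :
    Continuous (correlation v θ) := by
  have hloc : LocallyIntegrable v := hv.locallyIntegrable le_top
  have h := (hc.comp_homeomorph (Homeomorph.neg _)).continuous_convolution_right
    (ContinuousLinearMap.mul ℂ ℂ) hloc (hθ.comp continuous_neg)
  refine h.congr fun y => ?_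
  simp only [convolution_def, correlation, ContinuousLinearMap.mul_apply', Function.comp_apply,
    Homeomorph.coe_neg, neg_sub]

/-- For large `y` the translate of `θ` lives only where `v` is small. -/
theorem tendsto_correlation_cocompact (hv : VanishesAtInfinityAE v) (hθ : Integrable θ)
    (hc : HasCompactSupport θ) :
    Tendsto (correlation v θ) (cocompact (EuclideanSpace ℝ (Fin n))) (𝓝 0) := by
  obtain ⟨ρ, hρ⟩ := hc.isCompact.isBounded.exists_norm_le
  rw [Metric.tendsto_nhds]
  intro ε hε
  have hI : 0 ≤ ∫ x, ‖θ x‖ := integral_nonneg fun _ => norm_nonneg _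
  obtain ⟨R, hR⟩ := hv (ε / ((∫ x, ‖θ x‖) + 1)) (by positivity)
  filter_upwards [(tendsto_norm_cocompact_atTop
    (E := EuclideanSpace ℝ (Fin n))).eventually_ge_atTop (R + ρ)] with y hy
  rw [dist_zero_right]
  have hlt : ε / ((∫ x, ‖θ x‖) + 1) * ∫ x, ‖θ x‖ < ε := by
    rw [div_mul_eq_mul_div, div_lt_iff₀ (by positivity)]
    nlinarith
  refine lt_of_le_of_lt ?_ hlt
  set δ := ε / ((∫ x, ‖θ x‖) + 1)
  rw [← integral_sub_right_eq_self (fun x => ‖θ x‖) y, ← integral_const_mul]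
  refine norm_integral_le_of_norm_le ((hθ.comp_sub_right y).norm.const_mul _) ?_
  filter_upwards [hR] with x hx
  rw [norm_mul]
  by_cases h0 : θ (x - y) = 0
  · simp [h0]
  · refine mul_le_mul_of_nonneg_right (hx ?_).le (norm_nonneg _)
    have h1 := hρ (x - y) (subset_tsupport _ h0)
    have h2 : ‖y‖ ≤ ‖x‖ + ‖x - y‖ := by
      calc ‖y‖ = ‖x - (x - y)‖ := by congr 1; abel
        _ ≤ _ := norm_sub_le _ _
    linarith

/-- Testing `v` against the inverse Fourier transform of `𝓕 K (ε ξ) 𝓕 θ (ξ)`. -/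
theorem integral_mul_fourierInv_dilation (hv : MemLp v ∞) (K θ : 𝓢(EuclideanSpace ℝ (Fin n), ℂ))
    (ε : ℝ) :
    Integrable (fun x => v x * 𝓕⁻ (fun ξ => 𝓕 (K : EuclideanSpace ℝ (Fin n) → ℂ) (ε • ξ) *
      𝓕 (θ : EuclideanSpace ℝ (Fin n) → ℂ) ξ) x) ∧
    ∫ x, v x * 𝓕⁻ (fun ξ => 𝓕 (K : EuclideanSpace ℝ (Fin n) → ℂ) (ε • ξ) *
      𝓕 (θ : EuclideanSpace ℝ (Fin n) → ℂ) ξ) x = ∫ y, K y * correlation v θ (ε • y) := by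
  have hcont : Continuous fun p : EuclideanSpace ℝ (Fin n) × EuclideanSpace ℝ (Fin n) =>
      K p.2 * θ (p.1 - ε • p.2) := by
    have := K.continuous
    have := θ.continuous
    fun_prop
  have hint0 : Integrable (fun p : EuclideanSpace ℝ (Fin n) × EuclideanSpace ℝ (Fin n) =>
      K p.2 * θ (p.1 - ε • p.2)) (volume.prod volume) := by
    refine (integrable_prod_iff' hcont.aestronglyMeasurable).2
      ⟨Eventually.of_forall fun y => (θ.integrable.comp_sub_right (ε • y)).const_mul (K y), ?_⟩
    refine (K.integrable.norm.mul_const (∫ x, ‖θ x‖)).congr (Eventually.of_forall fun y => ?_)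
    simp only [norm_mul]
    rw [integral_const_mul, integral_sub_right_eq_self (fun x => ‖θ x‖) (ε • y)]
  have hint : Integrable (Function.uncurry fun x y : EuclideanSpace ℝ (Fin n) =>
      v x * (K y * θ (x - ε • y))) (volume.prod volume) := by
    have hb : ∀ᵐ p : EuclideanSpace ℝ (Fin n) × EuclideanSpace ℝ (Fin n) ∂(volume.prod volume),
        ‖v p.1‖ ≤ (eLpNorm v ∞ volume).toReal :=
      Measure.quasiMeasurePreserving_fst.ae (ae_norm_le_toReal_eLpNorm_top hv)
    exact hint0.bdd_mul hv.1.comp_fst hb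
  have e : ∀ x, v x * 𝓕⁻ (fun ξ => 𝓕 (K : EuclideanSpace ℝ (Fin n) → ℂ) (ε • ξ) *
      𝓕 (θ : EuclideanSpace ℝ (Fin n) → ℂ) ξ) x = ∫ y, v x * (K y * θ (x - ε • y)) := fun x => by
    rw [← integral_mul_fourierInv_sub_smul K.integrable (integrable_fourier_schwartzMap θ) ε x,
      fourierInv_fourier_schwartzMap, integral_const_mul]
  simp_rw [e]
  refine ⟨hint.integral_prod_left, ?_⟩
  rw [integral_integral_swap hint]
  congr 1 with y
  rw [correlation, ← integral_const_mul]
  congr 1 with x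
  ring

/-- A smooth compactly supported function that vanishes near the origin is divisible by the
multiplier of the fractional Laplacian. -/
theorem exists_fracLaplacianSchwartz_eq_fourierInv (s : ℝ)
    {m : EuclideanSpace ℝ (Fin n) → ℂ} (hm : ContDiff ℝ (⊤ : ℕ∞) m)
    (hc : HasCompactSupport m) (h0 : m =ᶠ[𝓝 0] 0) :
    ∃ φ : 𝓢(EuclideanSpace ℝ (Fin n), ℂ), fracLaplacianSchwartz s φ = 𝓕⁻ m := by
  have hsm : ContDiff ℝ (⊤ : ℕ∞) fun ξ : EuclideanSpace ℝ (Fin n) =>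
      (((2 * Real.pi * ‖ξ‖) ^ (-(2 * s)) : ℝ) : ℂ) * m ξ := by
    rw [contDiff_iff_contDiffAt]
    intro ξ
    rcases eq_or_ne ξ 0 with rfl | hξ
    · refine contDiffAt_const (c := (0 : ℂ)) |>.congr_of_eventuallyEq ?_
      filter_upwards [h0] with ξ hξ
      simp [hξ]
    · have h1 : ContDiffAt ℝ (⊤ : ℕ∞)
          (fun ξ : EuclideanSpace ℝ (Fin n) => (2 * Real.pi * ‖ξ‖) ^ (-(2 * s))) ξ :=
        (contDiffAt_const.mul (contDiffAt_norm ℝ hξ)).rpow_const_of_ne (by positivity)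
      exact (Complex.ofRealCLM.contDiff.contDiffAt.comp ξ h1).mul hm.contDiffAt
  have hcm : HasCompactSupport fun ξ : EuclideanSpace ℝ (Fin n) =>
      (((2 * Real.pi * ‖ξ‖) ^ (-(2 * s)) : ℝ) : ℂ) * m ξ := hc.mul_left
  -- The witness has Fourier transform `|ξ|^{-2s} m`, smooth because `m` vanishes near the
  -- singularity.
  refine ⟨𝓕⁻ (hcm.toSchwartzMap hsm), ?_⟩
  rw [fracLaplacianSchwartz_eq]
  congr 1
  funext ξ
  rw [← SchwartzMap.fourier_coe, FourierTransform.fourier_fourierInv_eq]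
  change _ * ((((2 * Real.pi * ‖ξ‖) ^ (-(2 * s)) : ℝ) : ℂ) * m ξ) = m ξ
  rcases eq_or_ne ξ 0 with rfl | hξ
  · rw [h0.eq_of_nhds]; simp
  · have hρ : 0 < 2 * Real.pi * ‖ξ‖ := by positivity
    rw [← mul_assoc, ← Complex.ofReal_mul, ← Real.rpow_add hρ]
    simp

/-- Liouville's theorem: a bounded function that vanishes at infinity and is annihilated by the
fractional Laplacian is zero. -/
theorem ae_eq_zero_of_fracLaplacian_eq_zero {s : ℝ} (hn : 0 < n) (hv : MemLp v ∞)
    (hv0 : VanishesAtInfinityAE v)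
    (hs : ∀ φ : 𝓢(EuclideanSpace ℝ (Fin n), ℂ), ∫ x, v x * fracLaplacianSchwartz s φ x = 0) :
    ∀ᵐ x, v x = 0 := by
  have : Nonempty (Fin n) := ⟨⟨0, hn⟩⟩
  refine ae_eq_zero_of_integral_contDiff_smul_eq_zero (hv.locallyIntegrable le_top)
    fun g hg hgc => ?_
  have hgc' : HasCompactSupport fun x => (g x : ℂ) := hgc.comp_left (g := ((↑) : ℝ → ℂ)) (by simp)
  have hg' : ContDiff ℝ (⊤ : ℕ∞) fun x => (g x : ℂ) := Complex.ofRealCLM.contDiff.comp hg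
  let θ : 𝓢(EuclideanSpace ℝ (Fin n), ℂ) := hgc'.toSchwartzMap hg'
  have hθc : HasCompactSupport (θ : EuclideanSpace ℝ (Fin n) → ℂ) := hgc'
  let b : ContDiffBump (0 : EuclideanSpace ℝ (Fin n)) := ⟨1, 2, one_pos, one_lt_two⟩
  have hbc : HasCompactSupport fun x => (b x : ℂ) :=
    b.hasCompactSupport.comp_left (g := ((↑) : ℝ → ℂ)) (by simp)
  have hb : ContDiff ℝ (⊤ : ℕ∞) fun x => (b x : ℂ) := Complex.ofRealCLM.contDiff.comp b.contDiff
  let K : 𝓢(EuclideanSpace ℝ (Fin n), ℂ) := 𝓕⁻ (hbc.toSchwartzMap hb)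
  have hK : 𝓕 (K : EuclideanSpace ℝ (Fin n) → ℂ) = fun x => (b x : ℂ) := by
    rw [← SchwartzMap.fourier_coe, FourierTransform.fourier_fourierInv_eq]
    rfl
  have hθs : ContDiff ℝ (⊤ : ℕ∞) (𝓕 (θ : EuclideanSpace ℝ (Fin n) → ℂ)) := by
    rw [← SchwartzMap.fourier_coe]
    exact (𝓕 θ).smooth ⊤
  -- the integrals do not depend on the dilation parameter
  have hconst : ∀ ε > (0 : ℝ), ∀ R > (0 : ℝ), ∫ y, K y * correlation v θ (ε • y) =
      ∫ y, K y * correlation v θ (R • y) := by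
    intro ε hε R hR
    obtain ⟨i1, e1⟩ := integral_mul_fourierInv_dilation hv K θ ε
    obtain ⟨i2, e2⟩ := integral_mul_fourierInv_dilation hv K θ R
    rw [← e1, ← e2, ← sub_eq_zero, ← integral_sub i1 i2]
    have hcs : ∀ r > (0 : ℝ), ContDiff ℝ (⊤ : ℕ∞) (fun ξ => (b (r • ξ) : ℂ) *
        𝓕 (θ : EuclideanSpace ℝ (Fin n) → ℂ) ξ) ∧ HasCompactSupport (fun ξ => (b (r • ξ) : ℂ) *
        𝓕 (θ : EuclideanSpace ℝ (Fin n) → ℂ) ξ) := fun r hr =>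
      ⟨(hb.comp (contDiff_const_smul r)).mul hθs,
        (hbc.comp_smul hr.ne').mul_right⟩
    have hone : ∀ r > (0 : ℝ), ∀ᶠ ξ in 𝓝 (0 : EuclideanSpace ℝ (Fin n)), b (r • ξ) = 1 := by
      intro r hr
      have ht : Tendsto (fun ξ : EuclideanSpace ℝ (Fin n) => r • ξ) (𝓝 0) (𝓝 0) := by
        simpa using (continuous_const_smul r).tendsto (0 : EuclideanSpace ℝ (Fin n))
      exact ht.eventually b.eventuallyEq_one
    -- Both dilated bumps equal 1 near the origin, so their difference vanishes there.
    obtain ⟨φ, hφ⟩ := exists_fracLaplacianSchwartz_eq_fourierInv s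
      ((hcs ε hε).1.sub (hcs R hR).1) ((hcs ε hε).2.sub (hcs R hR).2) (by
        filter_upwards [hone ε hε, hone R hR] with ξ h1 h2
        simp [h1, h2])
    rw [← hs φ, hφ]
    congr 1 with x
    rw [← mul_sub]
    congr 1
    have j : ∀ r : ℝ, Integrable (fun ξ => (b (r • ξ) : ℂ) *
        𝓕 (θ : EuclideanSpace ℝ (Fin n) → ℂ) ξ) := fun r =>
      (integrable_fourier_schwartzMap θ).bdd_mul (c := 1)
        (hb.continuous.comp (continuous_const_smul r)).aestronglyMeasurable
        (Eventually.of_forall fun ξ => by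
          rw [Complex.norm_real, Real.norm_of_nonneg b.nonneg]; exact b.le_one)
    simp only [hK, Real.fourierInv_eq, smul_sub]
    exact (integral_sub ((integrable_fourierChar_smul_iff x).2 (j ε))
      ((integrable_fourierChar_smul_iff x).2 (j R))).symm
  have hM := ae_norm_le_toReal_eLpNorm_top hv
  have hcontc := continuous_correlation hv θ.continuous hθc
  have hmeas : ∀ r : ℝ, AEStronglyMeasurable fun y => K y * correlation v θ (r • y) := fun r =>
    (K.continuous.mul (hcontc.comp (continuous_const_smul r))).aestronglyMeasurable
  have hbound : ∀ r : ℝ, ∀ᵐ y, ‖K y * correlation v θ (r • y)‖ ≤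
      ‖K y‖ * ((eLpNorm v ∞ volume).toReal * ∫ x, ‖θ x‖) := fun r =>
    Eventually.of_forall fun y => by
      rw [norm_mul]
      exact mul_le_mul_of_nonneg_left (norm_correlation_le hM θ.integrable _) (norm_nonneg _)
  have hKi : Integrable fun y => ‖K y‖ * ((eLpNorm v ∞ volume).toReal * ∫ x, ‖θ x‖) :=
    K.integrable.norm.mul_const _
  have hlim0 : Tendsto (fun r : ℝ => ∫ y, K y * correlation v θ (r • y)) (𝓝[>] 0)
      (𝓝 (∫ y, K y * correlation v θ 0)) := by
    refine tendsto_integral_filter_of_dominated_convergence _ (Eventually.of_forall hmeas)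
      (Eventually.of_forall hbound) hKi (Eventually.of_forall fun y => ?_)
    refine Tendsto.const_mul (K y) ?_
    have h1 : Tendsto (fun r : ℝ => correlation v θ (r • y)) (𝓝 0)
        (𝓝 (correlation v θ ((0 : ℝ) • y))) :=
      (hcontc.comp (continuous_id.smul continuous_const)).tendsto 0
    rw [zero_smul] at h1
    exact h1.mono_left nhdsWithin_le_nhds
  -- For `y ≠ 0` the point `r • y` escapes to infinity, where the correlation tends to 0.
  have hlim1 : Tendsto (fun r : ℝ => ∫ y, K y * correlation v θ (r • y)) atTop
      (𝓝 (∫ _ : EuclideanSpace ℝ (Fin n), (0 : ℂ))) := by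
    refine tendsto_integral_filter_of_dominated_convergence _ (Eventually.of_forall hmeas)
      (Eventually.of_forall hbound) hKi ?_
    filter_upwards [Measure.ae_ne volume (0 : EuclideanSpace ℝ (Fin n))] with y hy
    rw [← mul_zero (K y)]
    refine Tendsto.const_mul (K y)
      ((tendsto_correlation_cocompact hv0 θ.integrable hθc).comp ?_)
    rw [← Metric.cobounded_eq_cocompact, ← tendsto_norm_atTop_iff_cobounded]
    simp_rw [norm_smul]
    exact tendsto_norm_atTop_atTop.atTop_mul_const (norm_pos_iff.2 hy)
  have hzero : ∫ y, K y * correlation v θ 0 = 0 := by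
    have h1 : Tendsto (fun r : ℝ => ∫ y, K y * correlation v θ (r • y)) (𝓝[>] 0)
        (𝓝 (∫ y, K y * correlation v θ ((1 : ℝ) • y))) := by
      refine tendsto_const_nhds.congr' ?_
      filter_upwards [self_mem_nhdsWithin] with r hr using hconst 1 one_pos r hr
    have h2 : Tendsto (fun r : ℝ => ∫ y, K y * correlation v θ (r • y)) atTop
        (𝓝 (∫ y, K y * correlation v θ ((1 : ℝ) • y))) := by
      refine tendsto_const_nhds.congr' ?_
      filter_upwards [eventually_gt_atTop 0] with r hr using hconst 1 one_pos r hr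
    rw [tendsto_nhds_unique hlim0 h1, tendsto_nhds_unique h2 hlim1, integral_zero]
  -- The integral of `K` is its Fourier transform at 0, which is the value of the bump there.
  have hKone : ∫ y, K y = 1 := by
    have h1 := congrFun hK 0
    rw [Real.fourier_eq] at h1
    simpa [b.eventuallyEq_one.eq_of_nhds] using h1
  rw [integral_mul_const, hKone, one_mul] at hzero
  rw [← hzero, correlation]
  congr 1 with x
  rw [sub_zero, Complex.real_smul, mul_comm]
  rfl

end Liouville

/-! ### From pointwise estimates to the extended norms. -/

section Norms

variable {n : ℕ}

theorem holderWith_of_norm_sub_le {E F : Type*} [NormedAddCommGroup E] [NormedAddCommGroup F]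
    {u : E → F} {H : ℝ} {a : ℝ≥0} (hH : 0 ≤ H)
    (hu : ∀ x y, ‖u y - u x‖ ≤ H * ‖y - x‖ ^ (a : ℝ)) : HolderWith H.toNNReal a u := by
  intro x y
  rw [edist_dist, edist_dist, ENNReal.ofReal_rpow_of_nonneg dist_nonneg (NNReal.coe_nonneg _)]
  change _ ≤ ENNReal.ofReal H * _
  rw [← ENNReal.ofReal_mul hH, dist_eq_norm, dist_eq_norm]
  exact ENNReal.ofReal_le_ofReal (hu y x)

theorem eHolderNorm_le_ofReal {E F : Type*} [NormedAddCommGroup E] [NormedAddCommGroup F]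
    {u : E → F} {H : ℝ} {a : ℝ≥0} (hH : 0 ≤ H)
    (hu : ∀ x y, ‖u y - u x‖ ≤ H * ‖y - x‖ ^ (a : ℝ)) : eHolderNorm a u ≤ ENNReal.ofReal H :=
  (holderWith_of_norm_sub_le hH hu).eHolderNorm_le

/-- The set where the bound holds is closed by continuity and dense because its complement is null.
-/
theorem norm_le_toReal_eLpNorm_top_of_continuous {u : EuclideanSpace ℝ (Fin n) → ℂ}
    (hu : MemLp u ∞) (hc : Continuous u) (x : EuclideanSpace ℝ (Fin n)) :
    ‖u x‖ ≤ (eLpNorm u ∞ volume).toReal := by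
  have hd := Measure.dense_of_ae (ae_norm_le_toReal_eLpNorm_top hu)
  have hcl : IsClosed {x | ‖u x‖ ≤ (eLpNorm u ∞ volume).toReal} :=
    isClosed_le hc.norm continuous_const
  have : x ∈ closure {x | ‖u x‖ ≤ (eLpNorm u ∞ volume).toReal} := hd x
  rwa [hcl.closure_eq] at this

theorem iSup_enorm_le_ofReal {X F : Type*} [NormedAddCommGroup F] {u : X → F} {S : ℝ}
    (h : ∀ x, ‖u x‖ ≤ S) : ⨆ x, ‖u x‖ₑ ≤ ENNReal.ofReal S :=
  iSup_le fun x => by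
    rw [← ofReal_norm]
    exact ENNReal.ofReal_le_ofReal (h x)

theorem zygmundSeminorm_le_ofReal {u : EuclideanSpace ℝ (Fin n) → ℂ} {H : ℝ}
    (h : ∀ x h, h ≠ 0 → ‖u (x + h) + u (x - h) - 2 * u x‖ ≤ H * ‖h‖) :
    zygmundSeminorm u ≤ ENNReal.ofReal H := by
  refine iSup_le fun x => iSup_le fun y => iSup_le fun hy => ?_
  have hy' : 0 < ‖y‖ := norm_pos_iff.2 hy
  rw [← ofReal_norm, ← ofReal_norm, ← ENNReal.ofReal_div_of_pos hy']
  exact ENNReal.ofReal_le_ofReal ((div_le_iff₀ hy').2 (h x y hy))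

theorem integrable_of_memLp_top_of_compact {f : EuclideanSpace ℝ (Fin n) → ℂ} (hf : MemLp f ∞)
    {K : Set (EuclideanSpace ℝ (Fin n))} (hK : IsCompact K)
    (hfK : ∀ᵐ x ∂volume, x ∉ K → f x = 0) : Integrable f := by
  have h : IntegrableOn f K :=
    Measure.integrableOn_of_bounded hK.measure_lt_top.ne hf.1
      (ae_restrict_of_ae (ae_norm_le_toReal_eLpNorm_top hf))
  refine ((integrable_indicator_iff hK.isClosed.measurableSet).2 h).congr ?_
  filter_upwards [hfK] with x hx
  by_cases hxK : x ∈ K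
  · rw [indicator_of_mem hxK]
  · rw [indicator_of_notMem hxK, hx hxK]

theorem VanishesAtInfinityAE.sub_of_tendsto {w u : EuclideanSpace ℝ (Fin n) → ℂ}
    (hw : VanishesAtInfinityAE w)
    (hu : Tendsto u (cocompact (EuclideanSpace ℝ (Fin n))) (𝓝 0)) :
    VanishesAtInfinityAE fun x => w x - u x := by
  intro ε hε
  obtain ⟨R₁, hR₁⟩ := hw (ε / 2) (half_pos hε)
  rw [← Metric.cobounded_eq_cocompact] at hu
  obtain ⟨R₂, -, hR₂⟩ := hasBasis_cobounded_norm.eventually_iff.1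
    (Metric.tendsto_nhds.1 hu (ε / 2) (half_pos hε))
  refine ⟨max R₁ R₂, ?_⟩
  filter_upwards [hR₁] with x hx hxR
  have h1 := hx ((le_max_left _ _).trans hxR)
  have h2 := hR₂ (show x ∈ {x | R₂ ≤ ‖x‖} from (le_max_right _ _).trans hxR)
  rw [dist_zero_right] at h2
  linarith [norm_sub_le (w x) (u x)]

end Norms

/-! ### Assembly of the theorem. -/

section MainTheorem

variable {n : ℕ} {s : ℝ} {f : EuclideanSpace ℝ (Fin n) → ℂ}

theorem memLp_top_invFracLaplacian (hs0 : 0 < s) (hsn : s < (n : ℝ) / 2) (hf : Integrable f)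
    (hf' : MemLp f ∞) : MemLp (invFracLaplacian s f) ∞ := by
  have hM := ae_norm_le_toReal_eLpNorm_top hf'
  exact memLp_top_of_bound (continuous_invFracLaplacian hs0 hsn hf hM).aestronglyMeasurable _
    (Eventually.of_forall (norm_invFracLaplacian_le hs0 hsn hf hM))

theorem integrable_mul_schwartzMap (hf : MemLp f ∞) (φ : 𝓢(EuclideanSpace ℝ (Fin n), ℂ)) :
    Integrable fun x => f x * φ x :=
  φ.integrable.bdd_mul hf.1 (ae_norm_le_toReal_eLpNorm_top hf)

theorem fracLaplacianEqAE_invFracLaplacian (hs0 : 0 < s) (hs1 : s < 1) (hsn : s < (n : ℝ) / 2)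
    (hf : Integrable f) (hf' : MemLp f ∞) : FracLaplacianEqAE s (invFracLaplacian s f) f :=
  ⟨f, ⟨memLs_of_memLp_top hs0 (memLp_top_invFracLaplacian hs0 hsn hf hf'), fun φ =>
    ⟨integrable_mul_schwartzMap hf' φ, integral_invFracLaplacian_mul_fracLaplacianSchwartz
      hs0 hs1 hsn hf (ae_norm_le_toReal_eLpNorm_top hf') φ⟩⟩, EventuallyEq.rfl⟩

theorem ae_eq_invFracLaplacian (hs0 : 0 < s) (hs1 : s < 1) (hsn : s < (n : ℝ) / 2)
    (hf : Integrable f) (hf' : MemLp f ∞) {w : EuclideanSpace ℝ (Fin n) → ℂ} (hw : MemLp w ∞)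
    (hw0 : VanishesAtInfinityAE w) (hwf : FracLaplacianEqAE s w f) :
    w =ᵐ[volume] invFracLaplacian s f := by
  have hn : 0 < n := by
    rcases Nat.eq_zero_or_pos n with rfl | h
    · norm_num at hsn; linarith
    · exact h
  have hM := ae_norm_le_toReal_eLpNorm_top hf'
  have hu := memLp_top_invFracLaplacian hs0 hsn hf hf'
  obtain ⟨g, ⟨-, hg⟩, hgf⟩ := hwf
  have hz := ae_eq_zero_of_fracLaplacian_eq_zero (s := s) hn (hw.sub hu)
    (hw0.sub_of_tendsto (tendsto_invFracLaplacian_cocompact hs0 hsn hf hM)) fun φ => ?_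
  · filter_upwards [hz] with x hx
    exact sub_eq_zero.1 hx
  · have hψ := (integrable_symbol_mul_fourier hs0 hs1 φ).2
    have i1 := hψ.bdd_mul hw.1 (ae_norm_le_toReal_eLpNorm_top hw)
    have i2 := hψ.bdd_mul hu.1 (ae_norm_le_toReal_eLpNorm_top hu)
    -- The two pairings may be separated because `(-Δ)^s φ` is integrable and `w`, `u` are bounded.
    simp only [Pi.sub_apply, sub_mul]
    rw [integral_sub i1 i2, (hg φ).2,
      integral_invFracLaplacian_mul_fracLaplacianSchwartz hs0 hs1 hsn hf hM φ, sub_eq_zero]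
    refine integral_congr_ae ?_
    filter_upwards [hgf] with x hx
    rw [hx]

theorem holderNormZero_invFracLaplacian_le (hs0 : 0 < s) (hs : 2 * s < 1)
    (hsn : s < (n : ℝ) / 2) (hf : Integrable f) (hf' : MemLp f ∞) :
    holderNormZero (Real.toNNReal (2 * s)) (invFracLaplacian s f) ≤
      ENNReal.ofReal ((eLpNorm (invFracLaplacian s f) ∞ volume).toReal +
        |holderConst n s| * (eLpNorm f ∞ volume).toReal) := by
  have hM := ae_norm_le_toReal_eLpNorm_top hf'
  rw [ENNReal.ofReal_add ENNReal.toReal_nonneg (by positivity)]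
  refine add_le_add (iSup_enorm_le_ofReal (norm_le_toReal_eLpNorm_top_of_continuous
    (memLp_top_invFracLaplacian hs0 hsn hf hf') (continuous_invFracLaplacian hs0 hsn hf hM)))
    (eHolderNorm_le_ofReal (by positivity) fun x y => ?_)
  rw [Real.coe_toNNReal _ (by positivity)]
  refine (norm_invFracLaplacian_sub_le hs0 hs hsn hf hM x y).trans ?_
  gcongr
  exact le_abs_self _

theorem zygmundSeminorm_invFracLaplacian_le (hs0 : 0 < s) (hs : 2 * s = 1)
    (hsn : s < (n : ℝ) / 2) (hf : Integrable f) (hf' : MemLp f ∞) :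
    zygmundSeminorm (invFracLaplacian s f) ≤
      ENNReal.ofReal (|zygmundConst n s| * (eLpNorm f ∞ volume).toReal) := by
  refine zygmundSeminorm_le_ofReal fun x h hh => ?_
  have key := norm_invFracLaplacian_second_difference_le hs0 (by linarith) hsn hf
    (ae_norm_le_toReal_eLpNorm_top hf') x hh
  rw [hs, Real.rpow_one] at key
  refine key.trans ?_
  gcongr
  exact le_abs_self _

theorem holderNormOne_invFracLaplacian_le (hs1 : s < 1) (hs : 1 < 2 * s)
    (hsn : s < (n : ℝ) / 2) (hf : Integrable f) (hf' : MemLp f ∞) :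
    ContDiff ℝ 1 (invFracLaplacian s f) ∧
    holderNormOne (Real.toNNReal (2 * s - 1)) (invFracLaplacian s f) ≤
      ENNReal.ofReal (3 * (eLpNorm (invFracLaplacian s f) ∞ volume).toReal +
        2 * |holderGradConst n s| * (eLpNorm f ∞ volume).toReal) := by
  have hs0 : 0 < s := by linarith
  have ha : 0 < 2 * s - 1 := by linarith
  have hM := ae_norm_le_toReal_eLpNorm_top hf'
  set M := (eLpNorm f ∞ volume).toReal
  have hM0 : 0 ≤ M := ENNReal.toReal_nonneg
  set S := (eLpNorm (invFracLaplacian s f) ∞ volume).toReal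
  have hS0 : 0 ≤ S := ENNReal.toReal_nonneg
  have hd := hasFDerivAt_invFracLaplacian hs0 hs hsn hf hM
  have hfd : fderiv ℝ (invFracLaplacian s f) = invFracLaplacianGrad s f :=
    funext fun x => (hd x).fderiv
  have hS : ∀ x, ‖invFracLaplacian s f x‖ ≤ S := norm_le_toReal_eLpNorm_top_of_continuous
    (memLp_top_invFracLaplacian hs0 hsn hf hf') (continuous_invFracLaplacian hs0 hsn hf hM)
  have hH : ∀ x y, ‖invFracLaplacianGrad s f y - invFracLaplacianGrad s f x‖ ≤
      |holderGradConst n s| * M * ‖y - x‖ ^ (2 * s - 1) := fun x y => by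
    refine (norm_invFracLaplacianGrad_sub_le hs1 hs hsn hf hM x y).trans ?_
    gcongr
    exact le_abs_self _
  have hH' : ∀ x y, ‖invFracLaplacianGrad s f y - invFracLaplacianGrad s f x‖ ≤
      |holderGradConst n s| * M * ‖y - x‖ ^ ((2 * s - 1).toNNReal : ℝ) := by
    rwa [Real.coe_toNNReal _ ha.le]
  have hcont : Continuous (invFracLaplacianGrad s f) :=
    (holderWith_of_norm_sub_le (by positivity) hH').continuous (Real.toNNReal_pos.2 ha)
  refine ⟨contDiff_one_iff_fderiv.2 ⟨fun x => (hd x).differentiableAt, hfd ▸ hcont⟩, ?_⟩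
  rw [holderNormOne, hfd]
  -- The summands are `sup |u|`, the interpolation bound of `sup |Du|`, and the Hölder seminorm of
  -- `Du`.
  have e : 3 * S + 2 * |holderGradConst n s| * M = S + (2 * S + |holderGradConst n s| * M) +
      |holderGradConst n s| * M := by ring
  rw [e, ENNReal.ofReal_add (by positivity) (by positivity),
    ENNReal.ofReal_add (by positivity) (by positivity)]
  exact add_le_add (add_le_add (iSup_enorm_le_ofReal hS) (iSup_enorm_le_ofReal
    (norm_le_of_hasFDerivAt_of_holder hd hS (by positivity) ha.le hH)))
    (eHolderNorm_le_ofReal (by positivity) hH')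

theorem ofReal_le_mul_add {U M : ℝ≥0∞} (hU : U ≠ ∞) (hM : M ≠ ∞) {C a b : ℝ} (ha : a ≤ C)
    (hb : b ≤ C) (hC : 0 ≤ C) :
    ENNReal.ofReal (a * U.toReal + b * M.toReal) ≤ (C.toNNReal : ℝ≥0∞) * (U + M) := by
  have e : U + M = ENNReal.ofReal (U.toReal + M.toReal) := by
    rw [ENNReal.ofReal_add ENNReal.toReal_nonneg ENNReal.toReal_nonneg, ENNReal.ofReal_toReal hU,
      ENNReal.ofReal_toReal hM]
  rw [e]
  change _ ≤ ENNReal.ofReal C * _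
  rw [← ENNReal.ofReal_mul hC, mul_add]
  have := ENNReal.toReal_nonneg (a := U)
  have := ENNReal.toReal_nonneg (a := M)
  exact ENNReal.ofReal_le_ofReal (by gcongr)

end MainTheorem

theorem mainTheorem4 (n : ℕ) (s : ℝ) (hs0 : 0 < s) (hs1 : s < 1) (hsn : s < (n : ℝ) / 2) :
    ∃ C : ℝ≥0, 0 < C ∧
      ∀ f : EuclideanSpace ℝ (Fin n) → ℂ, MemLp f ∞ volume →
        (∃ K : Set (EuclideanSpace ℝ (Fin n)), IsCompact K ∧ ∀ᵐ x ∂volume, x ∉ K → f x = 0) →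
        -- the integral that defines `u = (-Δ)^{-s} f` converges absolutely at every point
        (∀ x, IntegrableOn (fun t : ℝ => t ^ (s - 1) • heatSemigroup t f x) (Ioi 0) volume) ∧
        -- regularity
        (2 * s < 1 →
          MemHolderZero (Real.toNNReal (2 * s)) (invFracLaplacian s f) ∧
          holderNormZero (Real.toNNReal (2 * s)) (invFracLaplacian s f) ≤
            C * (eLpNorm (invFracLaplacian s f) ∞ volume + eLpNorm f ∞ volume)) ∧
        (2 * s = 1 →
          MemZygmund (invFracLaplacian s f) ∧
          zygmundNorm (invFracLaplacian s f) ≤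
            C * (eLpNorm (invFracLaplacian s f) ∞ volume + eLpNorm f ∞ volume)) ∧
        (1 < 2 * s →
          MemHolderOne (Real.toNNReal (2 * s - 1)) (invFracLaplacian s f) ∧
          holderNormOne (Real.toNNReal (2 * s - 1)) (invFracLaplacian s f) ≤
            C * (eLpNorm (invFracLaplacian s f) ∞ volume + eLpNorm f ∞ volume)) ∧
        -- `u` is a bounded a.e. solution that vanishes at infinity
        (MemLp (invFracLaplacian s f) ∞ volume ∧
          Tendsto (invFracLaplacian s f) (cocompact (EuclideanSpace ℝ (Fin n))) (𝓝 0) ∧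
          FracLaplacianEqAE s (invFracLaplacian s f) f) ∧
        -- and the only one
        (∀ w : EuclideanSpace ℝ (Fin n) → ℂ, MemLp w ∞ volume → VanishesAtInfinityAE w →
          FracLaplacianEqAE s w f → w =ᵐ[volume] invFracLaplacian s f) := by
  -- One constant serves all three regimes. Absolute values are needed because `holderConst` and
  -- `holderGradConst` can be negative outside their own range of `s`.
  set C : ℝ := 3 + |holderConst n s| + |zygmundConst n s| + 2 * |holderGradConst n s| with hC
  have h1 := abs_nonneg (holderConst n s)
  have h2 := abs_nonneg (zygmundConst n s)
  have h3 := abs_nonneg (holderGradConst n s)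
  have hC0 : 0 < C := by positivity
  refine ⟨C.toNNReal, Real.toNNReal_pos.2 hC0, fun f hf' ⟨K, hK, hfK⟩ => ?_⟩
  have hf := integrable_of_memLp_top_of_compact hf' hK hfK
  have hM := ae_norm_le_toReal_eLpNorm_top hf'
  have hcont := continuous_invFracLaplacian hs0 hsn hf hM
  have hu := memLp_top_invFracLaplacian hs0 hsn hf hf'
  have hM' := hf'.eLpNorm_ne_top
  have hu' := hu.eLpNorm_ne_top
  refine ⟨integrableOn_rpow_smul_heatSemigroup hs0 hsn hf hM, fun hs => ?_, fun hs => ?_,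
    fun hs => ?_, ⟨hu, tendsto_invFracLaplacian_cocompact hs0 hsn hf hM,
      fracLaplacianEqAE_invFracLaplacian hs0 hs1 hsn hf hf'⟩,
    fun w hw hw0 hwf => ae_eq_invFracLaplacian hs0 hs1 hsn hf hf' hw hw0 hwf⟩
  · have key := holderNormZero_invFracLaplacian_le hs0 hs hsn hf hf'
    refine ⟨⟨hcont, key.trans_lt ENNReal.ofReal_lt_top⟩, key.trans ?_⟩
    rw [← one_mul (eLpNorm (invFracLaplacian s f) ∞ volume).toReal]
    exact ofReal_le_mul_add hu' hM' (by linarith) (by linarith) hC0.le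
  · have key := zygmundSeminorm_invFracLaplacian_le hs0 hs hsn hf hf'
    refine ⟨⟨hu, key.trans_lt ENNReal.ofReal_lt_top⟩, (add_le_add le_rfl key).trans ?_⟩
    rw [← ENNReal.ofReal_toReal hu', ← ENNReal.ofReal_add ENNReal.toReal_nonneg (by positivity),
      ENNReal.ofReal_toReal hu', ← one_mul (eLpNorm (invFracLaplacian s f) ∞ volume).toReal]
    exact ofReal_le_mul_add hu' hM' (by linarith) (by linarith) hC0.le
  · obtain ⟨hcd, key⟩ := holderNormOne_invFracLaplacian_le hs1 hs hsn hf hf'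
    exact ⟨⟨hcd, key.trans_lt ENNReal.ofReal_lt_top⟩,
      key.trans (ofReal_le_mul_add hu' hM' (by linarith) (by linarith) hC0.le)⟩
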